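/- Let $d,m\ge 0$ be integers, let $b_t:\mathbb R^d\to\mathbb R^d$ and $\sigma_t:\mathbb R^d\to\mathbb R^{d\times m}$ ($t\ge 0$), and consider the Euler scheme $$\hat X_{(n+1)h}=\hat X_{nh}+h\,b_{nh}(\hat X_{nh})+\sqrt h\,\sigma_{nh}(\hat X_{nh})\,\xi_n ,\qquad h>0,$$ where $\xi_0,\xi_1,\dots$ are i.i.d. standard Gaussian vectors in $\mathbb R^m$. For $S\ge 0$, say that $(\mathrm A_S)$ holds with constants $\alpha\in\mathbb R$ and $\lambda,\beta,\Lambda>0$ if for all $x,y\in\mathbb R^d$ and $t\in[0,S]$ $$\langle b_t(x)-b_t(y),x-y\rangle+\tfrac12\|\sigma_t(x)-\sigma_t(y)\|_{\rm HS}^2\le-\alpha\|x-y\|^2,\qquad \lambda I\preceq\sigma_t(x)\sigma_t(x)^{\mathsf T}\preceq\Lambda I,\qquad \|b_t(x)-b_t(y)\|\le\beta\|x-y\| .$$ Fix $x,y\in\mathbb R^d$ and let $\hat\mu_{nh}$, $\hat\nu_{nh}$ denote the laws of $\hat X_{nh}$ when the scheme is started from $x$ and from $y$, respectively. (1) Let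 $h>0$ and $N\ge1$, suppose that $(\mathrm A_{Nh})$ holds, and let $L>0$ satisfy $L^2=1-2\alpha h+\beta^2h^2$. If $L\ne1$, then $$\mathsf{KL}(\hat\mu_{Nh}\,\|\,\hat\nu_{Nh})\le\Bigl(1+\frac{4(\beta-\alpha)(\Lambda/\lambda)^3h}{L^2}\Bigr)\frac{\alpha-\beta^2h/2}{\lambda\,(L^{-2N}-1)}\,\|x-y\|^2 .$$ If $L=1$, the same bound holds with the second factor replaced by its limiting value $\frac1{2\lambda Nh}$. If $L<1$, then in particular $$\mathsf{KL}(\hat\mu_{Nh}\,\|\,\hat\nu_{Nh})\le\Bigl(1+\frac{4(\beta-\alpha)(\Lambda/\lambda)^3h}{L^2}\Bigr)\frac{\alpha\,(1-\beta h/2)}{\lambda\,(L^{-2N}-1)}\,\|x-y\|^2 .$$ (2) Let $T>0$, suppose that $(\mathrm A_S)$ holds, and let $h_k>0$, $N_k\in\mathbb N$ satisfy $h_k\to0$, $N_kh_k\to T$ and $N_kh_k\le S$ for all $k$. If the laws of the schemes with step size $h_k$ after $N_k$ steps, started from $x$ and from $y$, converge weakly to probability measures $\mu_T$ and $\nu_T$,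 respectively (the laws at time $T$ of the SDE $\mathrm dX_t=b_t(X_t)\,\mathrm dt+\sigma_t(X_t)\,\mathrm dB_t$ whenever the Euler scheme converges weakly to it), then $$\mathsf{KL}(\mu_T\,\|\,\nu_T)\le\frac{\alpha\,\|x-y\|^2}{\lambda\,(e^{2\alpha T}-1)},$$ where for $\alpha=0$ the right-hand side is read as its limiting value $\frac{\|x-y\|^2}{2\lambda T}$. -/

import Mathlib

open MeasureTheory ProbabilityTheory Filter Topology InformationTheory
open scoped BoundedContinuousFunction

namespace MultNoise

/-- The squared Hilbert–Schmidt norm of a real matrix. -/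
def hsNormSq {d m : ℕ} (A : Matrix (Fin d) (Fin m) ℝ) : ℝ :=
  ∑ i, ∑ j, A i j ^ 2

/-- Monotonicity (with constant `α : ℝ`) and uniform ellipticity (with constant `lam > 0`) of the
coefficients `b`, `σ` on the time interval `[0, T]`. -/
structure MonotoneElliptic {d m : ℕ}
    (b : ℝ → EuclideanSpace ℝ (Fin d) → EuclideanSpace ℝ (Fin d))
    (σ : ℝ → EuclideanSpace ℝ (Fin d) → Matrix (Fin d) (Fin m) ℝ)
    (T α lam : ℝ) : Prop where
  monotone : ∀ t ∈ Set.Icc 0 T, ∀ x y : EuclideanSpace ℝ (Fin d),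
    inner ℝ (b t x - b t y) (x - y) + 1 / 2 * hsNormSq (σ t x - σ t y) ≤ -α * ‖x - y‖ ^ 2
  lam_pos : 0 < lam
  elliptic : ∀ t ∈ Set.Icc 0 T, ∀ x : EuclideanSpace ℝ (Fin d),
    (σ t x * (σ t x).transpose - lam • (1 : Matrix (Fin d) (Fin d) ℝ)).PosSemidef

/-- Lipschitz drift (with constant `β > 0`) and upper bound `Lam > 0` on the diffusion matrix, on the
time interval `[0, T]`. -/
structure LipschitzBounded {d m : ℕ}
    (b : ℝ → EuclideanSpace ℝ (Fin d) → EuclideanSpace ℝ (Fin d))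
    (σ : ℝ → EuclideanSpace ℝ (Fin d) → Matrix (Fin d) (Fin m) ℝ)
    (T β Lam : ℝ) : Prop where
  beta_pos : 0 < β
  Lam_pos : 0 < Lam
  lipschitz : ∀ t ∈ Set.Icc 0 T, ∀ x y : EuclideanSpace ℝ (Fin d),
    ‖b t x - b t y‖ ≤ β * ‖x - y‖
  bounded : ∀ t ∈ Set.Icc 0 T, ∀ x : EuclideanSpace ℝ (Fin d),
    (Lam • (1 : Matrix (Fin d) (Fin d) ℝ) - σ t x * (σ t x).transpose).PosSemidef

/-- The Euler scheme with step size `h`, started from `x` and driven by the noise `ξ`: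
`euler b σ h ξ x n` is the random vector at time `n * h`. -/
noncomputable def euler {d m : ℕ} {Ω : Type*}
    (b : ℝ → EuclideanSpace ℝ (Fin d) → EuclideanSpace ℝ (Fin d))
    (σ : ℝ → EuclideanSpace ℝ (Fin d) → Matrix (Fin d) (Fin m) ℝ)
    (h : ℝ) (ξ : ℕ → Ω → EuclideanSpace ℝ (Fin m)) (x : EuclideanSpace ℝ (Fin d)) :
    ℕ → Ω → EuclideanSpace ℝ (Fin d)
  | 0 => fun _ => x
  | n + 1 => fun ω =>
      euler b σ h ξ x n ω + h • b (n * h) (euler b σ h ξ x n ω) +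
        Real.sqrt h •
          WithLp.toLp 2 ((σ (n * h) (euler b σ h ξ x n ω)).mulVec (WithLp.ofLp (ξ n ω)))

/-- Weak convergence of a sequence of measures on `ℝ^d`, tested on bounded continuous functions. -/
def WeaklyTendsto {d : ℕ} (ρ : ℕ → Measure (EuclideanSpace ℝ (Fin d)))
    (μ : Measure (EuclideanSpace ℝ (Fin d))) : Prop :=
  ∀ f : EuclideanSpace ℝ (Fin d) →ᵇ ℝ,
    Tendsto (fun k => ∫ z, f z ∂(ρ k)) atTop (𝓝 (∫ z, f z ∂μ))

end MultNoise

/-! The divergence is handled in dual form: `DVBound μ ν C` asks for ∫ f dμ ≤ C + log ∫ e^f dν over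
bounded measurable f. This form passes through maps, products and weak limits, and it returns a
bound on `klDiv` at the end (`DVBound.klDiv_le`).

Two properties of a single Euler step carry the result. Regularity (`dvBound_eulerStep`): the laws
after one step from x and y satisfy the bound with cost C‖x - y‖², where C = L²/(2λh) + O(1). It
comes from comparing Gaussians with different means and covariances (`dvBound_gaussian_affine`). The
covariance mismatch adds no 1/h term, because monotonicity and the Lipschitz drift force σ to be
Lipschitz (`hsNormSq_sub_le`); it is the source of the correction factor 1 + O(h). Contraction
(`integral_norm_sq_eulerStep_sub_le`): with the same noise, the mean squared distance is multiplied
by at most L².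

The two are combined by a dual shifted composition (`transition_le_log_transition_exp`). Let Q be
the kernel of one step and suppose g(x) ≤ F(y) + K‖x - y‖² for all x, y. Choose w between y and x:
coupling x with w costs K L²‖x - w‖², and regularity passes from w to y for C‖w - y‖². The best w
gives the same kind of inequality for Qg and log Q e^F, with 1/K' = 1/C + 1/(L²K). Starting from K =
C at the last step and moving backwards through the other N - 1 steps gives C / ∑_{i<N} L^{-2i}
(`dvBound_euler`).

Summing the geometric series gives the bounds for the scheme. As h → 0, L^{-2N} → e^{2αT}, the
correction factor tends to 1, and the dual inequality survives weak convergence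
(`DVBound.of_weaklyTendsto`). -/

namespace MultNoise

/-! ### The dual form of the Kullback–Leibler divergence. -/

section DonskerVaradhan

variable {α γ : Type*} [MeasurableSpace α] [MeasurableSpace γ]

/-- The Donsker–Varadhan form of the bound `klDiv μ ν ≤ C`, tested on bounded measurable
functions. -/
def DVBound (μ ν : Measure α) (C : ℝ) : Prop :=
  ∀ (f : α → ℝ) (M : ℝ), Measurable f → (∀ x, |f x| ≤ M) →
    ∫ x, f x ∂μ ≤ C + Real.log (∫ x, Real.exp (f x) ∂ν)

lemma integrable_of_abs_le {μ : Measure α} [IsFiniteMeasure μ] {f : α → ℝ} {M : ℝ}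
    (hf : Measurable f) (hM : ∀ x, |f x| ≤ M) : Integrable f μ :=
  Integrable.of_bound hf.aestronglyMeasurable M (ae_of_all _ hM)

lemma integrable_exp_of_abs_le {μ : Measure α} [IsFiniteMeasure μ] {f : α → ℝ} {M : ℝ}
    (hf : Measurable f) (hM : ∀ x, |f x| ≤ M) : Integrable (fun x => Real.exp (f x)) μ := by
  refine Integrable.of_bound (C := Real.exp M) (by fun_prop) (ae_of_all _ fun x => ?_)
  rw [Real.norm_eq_abs, Real.abs_exp]
  exact Real.exp_le_exp.2 ((le_abs_self _).trans (hM x))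

lemma abs_integral_le_of_abs_le {μ : Measure α} [IsProbabilityMeasure μ] {f : α → ℝ} {M : ℝ}
    (hM : ∀ x, |f x| ≤ M) : |∫ x, f x ∂μ| ≤ M := by
  have := norm_integral_le_of_norm_le_const (μ := μ) (f := f) (C := M) (ae_of_all _ hM)
  simpa using this

lemma exp_neg_le_integral_exp {μ : Measure α} [IsProbabilityMeasure μ] {f : α → ℝ} {M : ℝ}
    (hf : Measurable f) (hM : ∀ x, |f x| ≤ M) : Real.exp (-M) ≤ ∫ x, Real.exp (f x) ∂μ := by
  have := integral_mono (μ := μ) (integrable_const (Real.exp (-M)))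
    (integrable_exp_of_abs_le hf hM) (fun x => Real.exp_le_exp.2 (abs_le.1 (hM x)).1)
  simpa using this

lemma integral_exp_le_exp {μ : Measure α} [IsProbabilityMeasure μ] {f : α → ℝ} {M : ℝ}
    (hf : Measurable f) (hM : ∀ x, |f x| ≤ M) : ∫ x, Real.exp (f x) ∂μ ≤ Real.exp M := by
  have := integral_mono (μ := μ) (integrable_exp_of_abs_le hf hM)
    (integrable_const (Real.exp M)) (fun x => Real.exp_le_exp.2 (abs_le.1 (hM x)).2)
  simpa using this

lemma integral_exp_pos_of_abs_le {μ : Measure α} [IsProbabilityMeasure μ] {f : α → ℝ} {M : ℝ}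
    (hf : Measurable f) (hM : ∀ x, |f x| ≤ M) : 0 < ∫ x, Real.exp (f x) ∂μ :=
  (Real.exp_pos _).trans_le (exp_neg_le_integral_exp hf hM)

lemma abs_log_integral_exp_le {μ : Measure α} [IsProbabilityMeasure μ] {f : α → ℝ} {M : ℝ}
    (hf : Measurable f) (hM : ∀ x, |f x| ≤ M) :
    |Real.log (∫ x, Real.exp (f x) ∂μ)| ≤ M := by
  have hpos := integral_exp_pos_of_abs_le (μ := μ) hf hM
  rw [abs_le]
  exact ⟨(Real.le_log_iff_exp_le hpos).2 (exp_neg_le_integral_exp hf hM),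
    (Real.log_le_iff_le_exp hpos).2 (integral_exp_le_exp hf hM)⟩

/-- Jensen's inequality for the exponential. -/
lemma integral_le_log_integral_exp {μ : Measure α} [IsProbabilityMeasure μ] {g : α → ℝ}
    (hg : Integrable g μ) (hexp : Integrable (fun x => Real.exp (g x)) μ) :
    ∫ x, g x ∂μ ≤ Real.log (∫ x, Real.exp (g x) ∂μ) := by
  have hJ : Real.exp (∫ x, g x ∂μ) ≤ ∫ x, Real.exp (g x) ∂μ :=
    convexOn_exp.map_integral_le Real.continuous_exp.continuousOn isClosed_univ
      (ae_of_all _ fun _ => Set.mem_univ _) hg hexp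
  exact (Real.le_log_iff_exp_le ((Real.exp_pos _).trans_le hJ)).2 hJ

lemma DVBound.refl (μ : Measure α) [IsProbabilityMeasure μ] : DVBound μ μ 0 := by
  intro f M hf hM
  simpa using integral_le_log_integral_exp (integrable_of_abs_le (μ := μ) hf hM)
    (integrable_exp_of_abs_le hf hM)

lemma DVBound.mono {μ ν : Measure α} {C D : ℝ} (h : DVBound μ ν C) (hCD : C ≤ D) :
    DVBound μ ν D := fun f M hf hM => (h f M hf hM).trans (by linarith)

/-- Data processing. -/
lemma DVBound.map {μ ν : Measure α} {C : ℝ} (h : DVBound μ ν C) {T : α → γ} (hT : Measurable T) :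
    DVBound (μ.map T) (ν.map T) C := by
  intro f M hf hM
  rw [integral_map hT.aemeasurable hf.aestronglyMeasurable,
    integral_map hT.aemeasurable (by fun_prop)]
  exact h (fun x => f (T x)) M (hf.comp hT) (fun x => hM _)

/-- Integrating out the second variable turns f into g(x) = log ∫ e^{f(x,y)} dν₂(y). This g obeys
the same bound M, so it is an admissible test function for the first pair. -/
lemma DVBound.prod {μ₁ ν₁ : Measure α} {μ₂ ν₂ : Measure γ} [IsProbabilityMeasure μ₁]
    [IsProbabilityMeasure ν₁] [IsProbabilityMeasure μ₂] [IsProbabilityMeasure ν₂] {C₁ C₂ : ℝ}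
    (h₁ : DVBound μ₁ ν₁ C₁) (h₂ : DVBound μ₂ ν₂ C₂) :
    DVBound (μ₁.prod μ₂) (ν₁.prod ν₂) (C₁ + C₂) := by
  intro f M hf hM
  rw [integral_prod _ (integrable_of_abs_le hf hM),
    integral_prod _ (integrable_exp_of_abs_le hf hM)]
  set g : α → ℝ := fun x => Real.log (∫ y, Real.exp (f (x, y)) ∂ν₂) with hg
  have hfx : ∀ x, Measurable fun y => f (x, y) := fun x => hf.comp measurable_prodMk_left
  have hgm : Measurable g := by
    have : StronglyMeasurable fun x => ∫ y, Real.exp (f (x, y)) ∂ν₂ :=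
      StronglyMeasurable.integral_prod_right (f := fun x y => Real.exp (f (x, y)))
        (Real.measurable_exp.comp hf).stronglyMeasurable
    exact Real.measurable_log.comp this.measurable
  have hgM : ∀ x, |g x| ≤ M := fun x => abs_log_integral_exp_le (hfx x) fun y => hM _
  have hexp : ∀ x, Real.exp (g x) = ∫ y, Real.exp (f (x, y)) ∂ν₂ := fun x =>
    Real.exp_log (integral_exp_pos_of_abs_le (hfx x) fun y => hM _)
  have hle : ∫ x, ∫ y, f (x, y) ∂μ₂ ∂μ₁ ≤ ∫ x, (C₂ + g x) ∂μ₁ := by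
    refine integral_mono (Integrable.integral_prod_left (integrable_of_abs_le hf hM))
      ((integrable_const _).add (integrable_of_abs_le hgm hgM)) fun x => ?_
    exact h₂ _ M (hfx x) fun y => hM _
  rw [integral_add (integrable_const _) (integrable_of_abs_le hgm hgM)] at hle
  have := h₁ g M hgm hgM
  simp only [hexp] at this
  simp only [integral_const, probReal_univ, smul_eq_mul, one_mul] at hle
  linarith

lemma DVBound.pi {n : ℕ} {μ ν : Fin n → Measure α} [∀ i, IsProbabilityMeasure (μ i)]
    [∀ i, IsProbabilityMeasure (ν i)] {C : Fin n → ℝ} (h : ∀ i, DVBound (μ i) (ν i) (C i)) :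
    DVBound (Measure.pi μ) (Measure.pi ν) (∑ i, C i) := by
  induction n with
  | zero =>
    have : Measure.pi μ = Measure.pi ν := by congr 1; exact Subsingleton.elim _ _
    rw [this]
    simpa using DVBound.refl (Measure.pi ν)
  | succ n ih =>
    have hp := (h 0).prod (ih (μ := fun i => μ i.succ) (ν := fun i => ν i.succ)
      (C := fun i => C i.succ) fun i => h _)
    have e1 := (measurePreserving_piFinSuccAbove μ 0).symm
    have e2 := (measurePreserving_piFinSuccAbove ν 0).symm
    have := hp.map (MeasurableEquiv.piFinSuccAbove (fun _ => α) 0).symm.measurable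
    simp only [Fin.zero_succAbove] at e1 e2
    rw [e1.map_eq, e2.map_eq] at this
    rwa [Fin.sum_univ_succ]

/-- The Donsker–Varadhan bound controls the Kullback–Leibler divergence. -/
theorem DVBound.klDiv_le {μ ν : Measure α} [IsProbabilityMeasure μ] [IsProbabilityMeasure ν]
    {C : ℝ} (h : DVBound μ ν C) : klDiv μ ν ≤ ENNReal.ofReal C := by
  have hac : μ ≪ ν := by
    refine Measure.AbsolutelyContinuous.mk fun A hA hνA => ?_
    -- On a ν-null set A the test function n·1_A leaves the logarithmic term at 0; letting n grow
    -- forces μ(A) = 0.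
    have key : ∀ n : ℕ, n * μ.real A ≤ C := by
      intro n
      have hb : ∀ x, |A.indicator (fun _ => (n : ℝ)) x| ≤ n := by
        intro x
        by_cases hx : x ∈ A <;> simp [hx]
      have := h (A.indicator fun _ => (n : ℝ)) n (measurable_const.indicator hA) hb
      have hint : ∫ x, Real.exp (A.indicator (fun _ => (n : ℝ)) x) ∂ν = 1 := by
        have : (fun x => Real.exp (A.indicator (fun _ => (n : ℝ)) x)) =ᵐ[ν] fun _ => 1 := by
          have h0 : ∀ᵐ x ∂ν, x ∉ A := measure_eq_zero_iff_ae_notMem.1 hνA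
          filter_upwards [h0] with x hx
          simp [hx]
        rw [integral_congr_ae this]; simp
      rw [hint, integral_indicator_const _ hA] at this
      simpa [mul_comm] using this
    have : μ.real A ≤ 0 := by
      by_contra! hpos
      obtain ⟨n, hn⟩ := exists_nat_gt (C / μ.real A)
      rw [div_lt_iff₀ hpos] at hn
      exact absurd (key n) (not_le.2 hn)
    have h0 : μ.real A = 0 := le_antisymm this measureReal_nonneg
    simpa [measureReal_def, ENNReal.toReal_eq_zero_iff] using h0
  rw [klDiv_eq_lintegral_klFun_of_ac hac]
  set ρ : α → ℝ := fun x => (μ.rnDeriv ν x).toReal with hρ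
  have hρm : Measurable ρ := (Measure.measurable_rnDeriv μ ν).ennreal_toReal
  have hρ0 : ∀ x, 0 ≤ ρ x := fun x => ENNReal.toReal_nonneg
  -- The optimal test function log ρ may be unbounded; clamping ρ to [e^{-n}, e^n] makes it
  -- admissible, and Fatou's lemma removes the clamp.
  let ρn : ℕ → α → ℝ := fun n x => max (Real.exp (-n)) (min (ρ x) (Real.exp n))
  have hρnm : ∀ n, Measurable (ρn n) := fun n =>
    measurable_const.max (hρm.min measurable_const)
  have hρn_pos : ∀ n x, 0 < ρn n x := fun n x => (Real.exp_pos _).trans_le (le_max_left _ _)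
  have hρn_le : ∀ n x, ρn n x ≤ Real.exp n := fun n x =>
    max_le (Real.exp_le_exp.2 (by simp)) (min_le_right _ _)
  have hlog : ∀ n x, |Real.log (ρn n x)| ≤ n := by
    intro n x
    rw [abs_le]
    exact ⟨(Real.le_log_iff_exp_le (hρn_pos n x)).2 (le_max_left _ _),
      (Real.log_le_iff_le_exp (hρn_pos n x)).2 (hρn_le n x)⟩
  have hlogm : ∀ n, Measurable fun x => Real.log (ρn n x) := fun n =>
    Real.measurable_log.comp (hρnm n)
  -- Clamping raises ρ only where log ρn ≤ 0 and lowers it only where log ρn ≥ 0.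
  have hmul : ∀ n x, ρn n x * Real.log (ρn n x) ≤ ρ x * Real.log (ρn n x) := by
    intro n x
    rcases le_total (ρ x) (Real.exp (-n)) with h1 | h1
    · have e : ρn n x = Real.exp (-n) := by
        simp only [ρn]
        exact max_eq_left ((min_le_left _ _).trans h1)
      rw [e, Real.log_exp]
      have : (0 : ℝ) ≤ n := n.cast_nonneg
      nlinarith
    · rcases le_total (ρ x) (Real.exp n) with h2 | h2
      · have e : ρn n x = ρ x := by
          simp only [ρn]
          rw [min_eq_left h2, max_eq_right h1]
        rw [e]
      · have e : ρn n x = Real.exp n := by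
          simp only [ρn]
          rw [min_eq_right h2, max_eq_right (Real.exp_le_exp.2 (by simp))]
        rw [e, Real.log_exp]
        have : (0 : ℝ) ≤ n := n.cast_nonneg
        nlinarith
  have hlim : ∀ x, Tendsto (fun n => ENNReal.ofReal (klFun (ρn n x))) atTop
      (𝓝 (ENNReal.ofReal (klFun (ρ x)))) := by
    intro x
    have h1 : Tendsto (fun n : ℕ => Real.exp (n : ℝ)) atTop atTop :=
      Real.tendsto_exp_atTop.comp tendsto_natCast_atTop_atTop
    have h2 : Tendsto (fun n : ℕ => Real.exp (-(n : ℝ))) atTop (𝓝 0) :=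
      Real.tendsto_exp_neg_atTop_nhds_zero.comp tendsto_natCast_atTop_atTop
    have h3 : Tendsto (fun n : ℕ => min (ρ x) (Real.exp (n : ℝ))) atTop (𝓝 (ρ x)) := by
      refine tendsto_const_nhds.congr' ?_
      filter_upwards [h1.eventually_ge_atTop (ρ x)] with n hn
      rw [min_eq_left hn]
    have h4 : Tendsto (fun n => ρn n x) atTop (𝓝 (ρ x)) := by
      have := h2.max h3
      rwa [max_eq_right (hρ0 x)] at this
    exact (ENNReal.continuous_ofReal.comp continuous_klFun).continuousAt.tendsto.comp h4
  have hbound : ∀ n, ∫⁻ x, ENNReal.ofReal (klFun (ρn n x)) ∂ν ≤ ENNReal.ofReal C := by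
    intro n
    have hint_log : Integrable (fun x => Real.log (ρn n x)) μ :=
      integrable_of_abs_le (hlogm n) (hlog n)
    have hint_ρlog : Integrable (fun x => ρ x * Real.log (ρn n x)) ν := by
      have := (integrable_rnDeriv_smul_iff hac (f := fun x => Real.log (ρn n x))).2 hint_log
      simpa using this
    have hρlog : ∫ x, ρ x * Real.log (ρn n x) ∂ν = ∫ x, Real.log (ρn n x) ∂μ := by
      have := integral_rnDeriv_smul hac (f := fun x => Real.log (ρn n x))
      simpa using this
    have hint_ρn : Integrable (ρn n) ν :=
      integrable_of_abs_le (hρnm n) fun x => by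
        rw [abs_of_pos (hρn_pos n x)]; exact hρn_le n x
    have hint_ρn1 : Integrable (fun x => 1 - ρn n x) ν := (integrable_const 1).sub hint_ρn
    have hDV := h (fun x => Real.log (ρn n x)) n (hlogm n) (hlog n)
    simp only [Real.exp_log (hρn_pos n _)] at hDV
    have hpos : 0 < ∫ x, ρn n x ∂ν := by
      have := integral_exp_pos_of_abs_le (μ := ν) (hlogm n) (hlog n)
      simpa only [Real.exp_log (hρn_pos n _)] using this
    -- The clamped density need not have mass 1; the term 1 - ρn in `klFun` absorbs the error
    -- through log t ≤ t - 1.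
    have hl := Real.log_le_sub_one_of_pos hpos
    calc ∫⁻ x, ENNReal.ofReal (klFun (ρn n x)) ∂ν
        ≤ ∫⁻ x, ENNReal.ofReal (ρ x * Real.log (ρn n x) + (1 - ρn n x)) ∂ν := by
          refine lintegral_mono fun x => ENNReal.ofReal_le_ofReal ?_
          rw [klFun_apply]
          linarith [hmul n x]
      _ = ENNReal.ofReal (∫ x, (ρ x * Real.log (ρn n x) + (1 - ρn n x)) ∂ν) := by
          refine (ofReal_integral_eq_lintegral_ofReal (hint_ρlog.add hint_ρn1)
            (ae_of_all _ fun x => ?_)).symm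
          have := klFun_nonneg (hρn_pos n x).le
          rw [klFun_apply] at this
          have h' := hmul n x
          simp only [Pi.zero_apply, Pi.add_apply]
          linarith
      _ ≤ ENNReal.ofReal C := by
          refine ENNReal.ofReal_le_ofReal ?_
          rw [integral_add hint_ρlog hint_ρn1, hρlog, integral_sub (integrable_const 1) hint_ρn]
          simp only [integral_const, probReal_univ, smul_eq_mul, one_mul]
          linarith
  calc ∫⁻ x, ENNReal.ofReal (klFun (ρ x)) ∂ν
      = ∫⁻ x, liminf (fun n => ENNReal.ofReal (klFun (ρn n x))) atTop ∂ν := by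
        refine lintegral_congr fun x => ((hlim x).liminf_eq).symm
    _ ≤ liminf (fun n => ∫⁻ x, ENNReal.ofReal (klFun (ρn n x)) ∂ν) atTop :=
        lintegral_liminf_le fun n => (measurable_klFun.comp (hρnm n)).ennreal_ofReal
    _ ≤ ENNReal.ofReal C := by
        refine liminf_le_of_frequently_le' (Frequently.of_forall hbound)

/-- It suffices to test the Donsker–Varadhan bound on bounded continuous functions. -/
theorem DVBound.of_boundedContinuous {E : Type*} [MetricSpace E] [MeasurableSpace E] [BorelSpace E]
    {μ ν : Measure E} [IsProbabilityMeasure μ] [IsProbabilityMeasure ν] {C : ℝ}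
    (h : ∀ f : E →ᵇ ℝ, ∫ x, f x ∂μ ≤ C + Real.log (∫ x, Real.exp (f x) ∂ν)) :
    DVBound μ ν C := by
  intro f M hf hM
  have key : ∀ n : ℕ, ∃ g : E →ᵇ ℝ, (∀ x, |g x| ≤ M) ∧
      ∫ x, |f x - g x| ∂μ ≤ 1 / ((n : ℝ) + 1) ∧ ∫ x, |f x - g x| ∂ν ≤ 1 / ((n : ℝ) + 1) := by
    intro n
    -- Approximating in L¹(μ + ν) controls both measures with one function; clamping it to [-M, M]
    -- does not increase the error and makes the exponential Lipschitz on the relevant range.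
    have hmem : MemLp f 1 (μ + ν) := memLp_one_iff_integrable.2 (integrable_of_abs_le hf hM)
    have hε : ENNReal.ofReal (1 / ((n : ℝ) + 1)) ≠ 0 := by
      simp only [ne_eq, ENNReal.ofReal_eq_zero, not_le]; positivity
    obtain ⟨g, hg, hgmem⟩ := hmem.exists_boundedContinuous_eLpNorm_sub_le ENNReal.one_ne_top hε
    have hcont : Continuous fun x => max (-M) (min (g x) M) := by fun_prop
    have hb : ∀ x, |max (-M) (min (g x) M)| ≤ M := by
      intro x
      have hM0 : 0 ≤ M := (abs_nonneg _).trans (hM x)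
      rw [abs_le]
      exact ⟨le_max_left _ _, max_le (by linarith) (min_le_right _ _)⟩
    have hclip : ∀ x, |f x - max (-M) (min (g x) M)| ≤ |f x - g x| := by
      intro x
      obtain ⟨h1, h2⟩ := abs_le.1 (hM x)
      have e : f x = max (-M) (min (f x) M) := by rw [min_eq_left h2, max_eq_right h1]
      calc |f x - max (-M) (min (g x) M)|
          = |max (-M) (min (f x) M) - max (-M) (min (g x) M)| := by rw [← e]
        _ ≤ |min (f x) M - min (g x) M| := by
            have := abs_max_sub_max_le_max (-M) (min (f x) M) (-M) (min (g x) M)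
            simpa using this
        _ ≤ |f x - g x| := by
            have := abs_min_sub_min_le_max (f x) M (g x) M
            simpa using this
    let G : E →ᵇ ℝ := BoundedContinuousFunction.ofNormedAddCommGroup _ hcont M hb
    have hint : ∀ κ : Measure E, κ ≤ μ + ν → IsFiniteMeasure κ →
        ∫ x, |f x - G x| ∂κ ≤ 1 / ((n : ℝ) + 1) := by
      intro κ hκ _
      have hGi : Integrable (fun x => |f x - G x|) κ :=
        ((integrable_of_abs_le hf hM).sub (G.integrable κ)).abs
      rw [← ENNReal.ofReal_le_ofReal_iff (by positivity),
        ofReal_integral_eq_lintegral_ofReal hGi (ae_of_all _ fun x => abs_nonneg _)]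
      refine le_trans ?_ hg
      rw [eLpNorm_one_eq_lintegral_enorm]
      refine (lintegral_mono' hκ le_rfl).trans (lintegral_mono fun x => ?_)
      rw [← ofReal_norm]
      exact ENNReal.ofReal_le_ofReal (hclip x)
    exact ⟨G, hb, hint μ (Measure.le_add_right le_rfl) inferInstance,
      hint ν (Measure.le_add_left le_rfl) inferInstance⟩
  choose g hgM hgμ hgν using key
  have hlim0 : Tendsto (fun n : ℕ => 1 / ((n : ℝ) + 1)) atTop (𝓝 0) :=
    tendsto_one_div_add_atTop_nhds_zero_nat
  have hconv : ∀ κ : Measure E, IsProbabilityMeasure κ → ∀ (u : ℕ → E → ℝ) (v : E → ℝ) (K : ℝ),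
      (∀ n, Integrable (u n) κ) → Integrable v κ → (∀ n, Integrable (fun x => |f x - g n x|) κ) →
      (∀ n x, |v x - u n x| ≤ K * |f x - g n x|) → 0 ≤ K →
      (∀ n, ∫ x, |f x - g n x| ∂κ ≤ 1 / ((n : ℝ) + 1)) →
      Tendsto (fun n => ∫ x, u n x ∂κ) atTop (𝓝 (∫ x, v x ∂κ)) := by
    intro κ _ u v K hu hv hfg hK hK0 hb
    rw [tendsto_iff_dist_tendsto_zero]
    refine squeeze_zero (fun _ => dist_nonneg) (fun n => ?_)
      (by simpa only [mul_zero] using hlim0.const_mul K)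
    rw [dist_comm, Real.dist_eq, ← integral_sub hv (hu n)]
    calc |∫ x, (v x - u n x) ∂κ| ≤ ∫ x, |v x - u n x| ∂κ := abs_integral_le_integral_abs
      _ ≤ ∫ x, K * |f x - g n x| ∂κ :=
          integral_mono (hv.sub (hu n)).abs ((hfg n).const_mul K) (hK n)
      _ ≤ K * (1 / ((n : ℝ) + 1)) := by
          rw [integral_const_mul]
          exact mul_le_mul_of_nonneg_left (hb n) hK0
  have hgm : ∀ n, Measurable (g n) := fun n => (g n).continuous.measurable
  have h1 : Tendsto (fun n => ∫ x, g n x ∂μ) atTop (𝓝 (∫ x, f x ∂μ)) :=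
    hconv μ inferInstance (fun n => g n) f 1 (fun n => (g n).integrable μ)
      (integrable_of_abs_le hf hM)
      (fun n => ((integrable_of_abs_le hf hM).sub ((g n).integrable μ)).abs)
      (fun n x => by simp) zero_le_one hgμ
  have h2 : Tendsto (fun n => ∫ x, Real.exp (g n x) ∂ν) atTop (𝓝 (∫ x, Real.exp (f x) ∂ν)) := by
    refine hconv ν inferInstance (fun n x => Real.exp (g n x)) (fun x => Real.exp (f x))
      (Real.exp M) (fun n => integrable_exp_of_abs_le (hgm n) (hgM n))
      (integrable_exp_of_abs_le hf hM)
      (fun n => ((integrable_of_abs_le hf hM).sub ((g n).integrable ν)).abs)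
      (fun n x => ?_) (Real.exp_pos _).le hgν
    have hexp_le : ∀ a c : ℝ, a ≤ M → Real.exp a - Real.exp c ≤ Real.exp M * |a - c| := by
      intro a c ha
      have h1 : Real.exp a * (1 - (a - c)) ≤ Real.exp c := by
        have := Real.add_one_le_exp (c - a)
        calc Real.exp a * (1 - (a - c)) ≤ Real.exp a * Real.exp (c - a) :=
              mul_le_mul_of_nonneg_left (by linarith) (Real.exp_pos _).le
          _ = Real.exp c := by rw [← Real.exp_add]; ring_nf
      calc Real.exp a - Real.exp c ≤ Real.exp a * (a - c) := by linarith
        _ ≤ Real.exp a * |a - c| :=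
            mul_le_mul_of_nonneg_left (le_abs_self _) (Real.exp_pos _).le
        _ ≤ Real.exp M * |a - c| :=
            mul_le_mul_of_nonneg_right (Real.exp_le_exp.2 ha) (abs_nonneg _)
    refine abs_sub_le_iff.2 ⟨hexp_le _ _ (abs_le.1 (hM x)).2, ?_⟩
    rw [abs_sub_comm]
    exact hexp_le _ _ (abs_le.1 (hgM n x)).2
  refine le_of_tendsto_of_tendsto' h1
    ((h2.log (integral_exp_pos_of_abs_le hf hM).ne').const_add C) fun n => h (g n)

end DonskerVaradhan

end MultNoise

namespace MultNoise

/-! ### One-dimensional Gaussian divergences and covariance identities. -/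

section Gaussian

lemma gaussianPDFReal_std_eq {s : ℝ} (hs : 0 < s) (c z : ℝ) :
    gaussianPDFReal 0 1 z = gaussianPDFReal c (s ^ 2).toNNReal z *
      Real.exp (-(-Real.log s - (z - c) ^ 2 / (2 * s ^ 2) + z ^ 2 / 2)) := by
  have hc : (((s ^ 2).toNNReal : NNReal) : ℝ) = s ^ 2 := Real.coe_toNNReal _ (by positivity)
  simp only [gaussianPDFReal_def, hc]
  have e : -(-Real.log s - (z - c) ^ 2 / (2 * s ^ 2) + z ^ 2 / 2)
      = Real.log s + ((z - c) ^ 2 / (2 * s ^ 2) + -(z ^ 2 / 2)) := by ring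
  rw [e, Real.exp_add, Real.exp_add, Real.exp_log hs,
    Real.sqrt_mul (by positivity) (s ^ 2), Real.sqrt_sq hs.le]
  have h1 : Real.exp (-(z - c) ^ 2 / (2 * s ^ 2)) * Real.exp ((z - c) ^ 2 / (2 * s ^ 2)) = 1 := by
    rw [← Real.exp_add, neg_div, neg_add_cancel, Real.exp_zero]
  have h2 : -(z - 0) ^ 2 / (2 * ((1 : NNReal) : ℝ)) = -(z ^ 2 / 2) := by
    rw [NNReal.coe_one]; ring
  rw [h2, NNReal.coe_one, mul_one]
  have h3 : (√(2 * Real.pi) * s)⁻¹ * s = (√(2 * Real.pi))⁻¹ := by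
    field_simp
  calc (√(2 * Real.pi))⁻¹ * Real.exp (-(z ^ 2 / 2))
      = ((√(2 * Real.pi) * s)⁻¹ * s) * (Real.exp (-(z - c) ^ 2 / (2 * s ^ 2)) *
        Real.exp ((z - c) ^ 2 / (2 * s ^ 2))) * Real.exp (-(z ^ 2 / 2)) := by
        rw [h1, h3, mul_one]
    _ = _ := by ring

lemma integrable_sq_sub_gaussianReal (c a : ℝ) (v : NNReal) :
    Integrable (fun z => (z - a) ^ 2) (gaussianReal c v) :=
  ((memLp_id_gaussianReal 2).sub (memLp_const a)).integrable_sq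

lemma integral_sq_sub_gaussianReal (c : ℝ) (v : NNReal) :
    ∫ z, (z - c) ^ 2 ∂(gaussianReal c v) = v := by
  have h := variance_fun_id_gaussianReal (μ := c) (v := v)
  rw [variance_eq_integral aemeasurable_id', integral_id_gaussianReal] at h
  exact h

lemma integral_sq_gaussianReal (c : ℝ) (v : NNReal) :
    ∫ z, z ^ 2 ∂(gaussianReal c v) = v + c ^ 2 := by
  have hi : Integrable (fun z => z) (gaussianReal c v) :=
    memLp_one_iff_integrable.1 (memLp_id_gaussianReal 1)
  have h1 := integrable_sq_sub_gaussianReal c c v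
  have h2 : Integrable (fun z => 2 * c * z - c ^ 2) (gaussianReal c v) :=
    (hi.const_mul _).sub (integrable_const _)
  have e : ∀ z : ℝ, z ^ 2 = (z - c) ^ 2 + (2 * c * z - c ^ 2) := fun z => by ring
  rw [integral_congr_ae (ae_of_all _ e), integral_add h1 h2,
    integral_sub (hi.const_mul _) (integrable_const _), integral_sq_sub_gaussianReal,
    integral_const_mul, integral_id_gaussianReal]
  simp
  ring

/-- The constant is the exact divergence, the mean of the log-density ratio l. Changing measure
turns ∫ e^f dN(0,1) into ∫ e^{f-l} dN(c,s²), and Jensen's inequality finishes. -/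
lemma dvBound_gaussianReal {s : ℝ} (hs : 0 < s) (c : ℝ) :
    DVBound (gaussianReal c (s ^ 2).toNNReal) (gaussianReal 0 1)
      (-Real.log s + (s ^ 2 - 1 + c ^ 2) / 2) := by
  intro f M hf hM
  set v : NNReal := (s ^ 2).toNNReal with hv
  have hvc : (v : ℝ) = s ^ 2 := Real.coe_toNNReal _ (by positivity)
  have hv0 : v ≠ 0 := by
    intro h0
    rw [h0, NNReal.coe_zero] at hvc
    exact (pow_pos hs 2).ne hvc
  set l : ℝ → ℝ := fun z => -Real.log s - (z - c) ^ 2 / (2 * s ^ 2) + z ^ 2 / 2 with hl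
  have hlm : Measurable l := by fun_prop
  have hsq : Integrable (fun z => z ^ 2) (gaussianReal c v) := by
    simpa using integrable_sq_sub_gaussianReal c 0 v
  have hA : Integrable (fun z => -Real.log s - (z - c) ^ 2 / (2 * s ^ 2)) (gaussianReal c v) :=
    (integrable_const _).sub ((integrable_sq_sub_gaussianReal c c v).div_const _)
  have hli : Integrable l (gaussianReal c v) := hA.add (hsq.div_const _)
  have hlint : ∫ z, l z ∂(gaussianReal c v) = -Real.log s + (s ^ 2 - 1 + c ^ 2) / 2 := by
    simp only [hl]
    rw [integral_add hA (hsq.div_const _),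
      integral_sub (integrable_const _) ((integrable_sq_sub_gaussianReal c c v).div_const _),
      integral_div, integral_div, integral_sq_sub_gaussianReal, integral_sq_gaussianReal, hvc]
    simp
    field_simp
    ring
  have hfi : Integrable f (gaussianReal c v) := integrable_of_abs_le hf hM
  have hpdf : ∀ z, gaussianPDFReal 0 1 z • Real.exp (f z)
      = gaussianPDFReal c v z • Real.exp (f z - l z) := by
    intro z
    rw [gaussianPDFReal_std_eq hs c z, smul_eq_mul, smul_eq_mul, mul_assoc, ← Real.exp_add]
    congr 2
    simp only [hl]
    ring
  have hint : ∫ z, Real.exp (f z) ∂(gaussianReal 0 1)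
      = ∫ z, Real.exp (f z - l z) ∂(gaussianReal c v) := by
    rw [integral_gaussianReal_eq_integral_smul one_ne_zero,
      integral_gaussianReal_eq_integral_smul hv0]
    exact integral_congr_ae (ae_of_all _ hpdf)
  have hiff : ∀ (a : ℝ) (w : NNReal), w ≠ 0 → ∀ g : ℝ → ℝ, Integrable g (gaussianReal a w) ↔
      Integrable (fun z => gaussianPDFReal a w z • g z) := by
    intro a w hw g
    rw [gaussianReal_of_var_ne_zero _ hw, integrable_withDensity_iff_integrable_smul'
      (measurable_gaussianPDF _ _) (ae_of_all _ fun _ => gaussianPDF_lt_top)]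
    simp only [toReal_gaussianPDF]
  have hexpi : Integrable (fun z => Real.exp (f z - l z)) (gaussianReal c v) := by
    have h1 : Integrable (fun z => Real.exp (f z)) (gaussianReal 0 1) :=
      integrable_exp_of_abs_le hf hM
    rw [hiff _ _ one_ne_zero] at h1
    rw [hiff _ _ hv0]
    exact h1.congr (ae_of_all _ hpdf)
  have hJ := integral_le_log_integral_exp (hfi.sub hli) hexpi
  simp only [Pi.sub_apply] at hJ
  rw [integral_sub hfi hli, hlint, ← hint] at hJ
  linarith

/-- A centred Gaussian law `S ξ` depends on `S` only through `S Sᵀ`. -/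
lemma map_mulVec_stdGaussian_eq {d m n : ℕ} {A : Matrix (Fin d) (Fin m) ℝ}
    {B : Matrix (Fin d) (Fin n) ℝ} (h : A * A.transpose = B * B.transpose) :
    (stdGaussian (EuclideanSpace ℝ (Fin m))).map (fun z => WithLp.toLp 2 (A.mulVec z.ofLp)) =
      (stdGaussian (EuclideanSpace ℝ (Fin n))).map (fun z => WithLp.toLp 2 (B.mulVec z.ofLp)) := by
  have key : ∀ {k : ℕ} (D : Matrix (Fin d) (Fin k) ℝ) (t : EuclideanSpace ℝ (Fin d)),
      charFun ((stdGaussian (EuclideanSpace ℝ (Fin k))).map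
        (fun z => WithLp.toLp 2 (D.mulVec z.ofLp))) t =
        Complex.exp (-((t.ofLp ⬝ᵥ (D * D.transpose).mulVec t.ofLp : ℝ) : ℂ) / 2) := by
    intro k D t
    have hc : Continuous fun z : EuclideanSpace ℝ (Fin k) => WithLp.toLp 2 (D.mulVec z.ofLp) := by
      fun_prop
    have hin : ∀ z : EuclideanSpace ℝ (Fin k), inner ℝ (WithLp.toLp 2 (D.mulVec z.ofLp)) t
        = inner ℝ z (WithLp.toLp 2 (D.transpose.mulVec t.ofLp)) := by
      intro z
      simp only [EuclideanSpace.inner_eq_star_dotProduct, star_trivial]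
      rw [Matrix.mulVec_transpose, Matrix.dotProduct_mulVec]
    rw [charFun_apply, integral_map hc.aemeasurable (by fun_prop)]
    simp_rw [hin]
    rw [← charFun_apply, charFun_stdGaussian]
    congr 2
    norm_cast
    rw [EuclideanSpace.real_norm_sq_eq, ← Matrix.mulVec_mulVec, Matrix.dotProduct_mulVec, ← Matrix.mulVec_transpose]
    simp [dotProduct, sq]
  refine Measure.ext_of_charFun (funext fun t => ?_)
  rw [key, key, h]

lemma pi_gaussianReal_eq_map {d : ℕ} (c s : Fin d → ℝ) :
    Measure.pi (fun i => gaussianReal (c i) (s i ^ 2).toNNReal) =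
      (Measure.pi fun _ : Fin d => gaussianReal 0 1).map fun z i => c i + s i * z i := by
  rw [Measure.pi_map_pi (f := fun i t => c i + s i * t) (fun i => by fun_prop)]
  congr 1
  funext i
  have h1 : (fun t : ℝ => c i + s i * t) = (fun t => c i + t) ∘ fun t => s i * t := rfl
  rw [h1, ← Measure.map_map (by fun_prop) (by fun_prop), gaussianReal_map_const_mul,
    gaussianReal_map_const_add]
  congr 1
  · ring
  · ext
    simp [Real.coe_toNNReal _ (sq_nonneg (s i))]

end Gaussian

/-! ### Simultaneous diagonalisation by congruence. -/

section LinearAlgebra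

open Matrix
-- Write S₂ = BᵀB with B invertible and diagonalise the symmetric matrix B⁻ᵀS₁B⁻¹ = U diag(μ) Uᵀ;
-- then A = BᵀU works for both matrices.
open scoped MatrixOrder Matrix.Norms.L2Operator in
lemma exists_simultaneous_diagonalization {d : ℕ} {S₁ S₂ : Matrix (Fin d) (Fin d) ℝ}
    (h₁ : S₁.IsHermitian) (h₂ : S₂.PosDef) :
    ∃ (A : Matrix (Fin d) (Fin d) ℝ) (μ : Fin d → ℝ), IsUnit A.det ∧
      S₂ = A * A.transpose ∧ S₁ = A * diagonal μ * A.transpose := by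
  obtain ⟨B, hB, hS⟩ :=
    CStarAlgebra.isStrictlyPositive_iff_eq_star_mul_self.1 h₂.isStrictlyPositive
  rw [star_eq_conjTranspose] at hS
  rw [Matrix.isUnit_iff_isUnit_det] at hB
  rw [conjTranspose_eq_transpose_of_trivial] at hS
  have hBt : IsUnit Bᵀ.det := by rwa [det_transpose]
  have hM : (Bᵀ⁻¹ * S₁ * B⁻¹).IsHermitian := by
    rw [IsHermitian, conjTranspose_eq_transpose_of_trivial] at *
    rw [transpose_mul, transpose_mul, h₁, transpose_nonsing_inv, transpose_nonsing_inv,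
      transpose_transpose, Matrix.mul_assoc]
  have hU := hM.spectral_theorem
  set U : Matrix (Fin d) (Fin d) ℝ := (hM.eigenvectorUnitary : Matrix (Fin d) (Fin d) ℝ) with hUdef
  have hUU : U * Uᵀ = 1 := by
    have := Unitary.coe_mul_star_self hM.eigenvectorUnitary
    simpa [star_eq_conjTranspose] using this
  have hspec : Bᵀ⁻¹ * S₁ * B⁻¹ = U * diagonal hM.eigenvalues * Uᵀ := by
    rw [Unitary.conjStarAlgAut_apply] at hU
    simpa [star_eq_conjTranspose] using hU
  refine ⟨Bᵀ * U, hM.eigenvalues, ?_, ?_, ?_⟩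
  · rw [det_mul]
    refine hBt.mul ?_
    have := congrArg det hUU
    rw [det_mul, det_one] at this
    exact IsUnit.of_mul_eq_one _ this
  · rw [transpose_mul, transpose_transpose, Matrix.mul_assoc, ← Matrix.mul_assoc U, hUU,
      Matrix.one_mul, hS]
  · calc S₁ = Bᵀ * (Bᵀ⁻¹ * S₁ * B⁻¹) * B := by
          rw [Matrix.mul_assoc Bᵀ⁻¹, mul_nonsing_inv_cancel_left _ _ hBt, Matrix.mul_assoc,
            nonsing_inv_mul _ hB, Matrix.mul_one]
      _ = Bᵀ * (U * diagonal hM.eigenvalues * Uᵀ) * B := congrArg (fun Z => Bᵀ * Z * B) hspec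
      _ = _ := by
          rw [transpose_mul, transpose_transpose]
          simp only [Matrix.mul_assoc]

end LinearAlgebra

end MultNoise

namespace MultNoise

/-! ### Divergence between Gaussians with different means and covariances. -/

section GaussianKernel

open Matrix

lemma dotProduct_mul_transpose_mulVec {d m : ℕ} (S : Matrix (Fin d) (Fin m) ℝ) (v : Fin d → ℝ) :
    v ⬝ᵥ ((S * Sᵀ) *ᵥ v) = ∑ k, (v ᵥ* S) k ^ 2 := by
  rw [← mulVec_mulVec, dotProduct_mulVec, mulVec_transpose]
  simp [dotProduct, sq]

lemma mul_sum_sq_le_of_elliptic {d m : ℕ} {S : Matrix (Fin d) (Fin m) ℝ} {lam : ℝ}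
    (h : (S * Sᵀ - lam • (1 : Matrix (Fin d) (Fin d) ℝ)).PosSemidef) (v : Fin d → ℝ) :
    lam * ∑ i, v i ^ 2 ≤ ∑ k, (v ᵥ* S) k ^ 2 := by
  have := h.dotProduct_mulVec_nonneg v
  rw [star_trivial, sub_mulVec, dotProduct_sub, dotProduct_mul_transpose_mulVec, smul_mulVec,
    one_mulVec, dotProduct_smul, smul_eq_mul] at this
  simp only [dotProduct, ← sq] at this
  linarith

lemma sum_sq_le_mul_of_bounded {d m : ℕ} {S : Matrix (Fin d) (Fin m) ℝ} {Lam : ℝ}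
    (h : (Lam • (1 : Matrix (Fin d) (Fin d) ℝ) - S * Sᵀ).PosSemidef) (v : Fin d → ℝ) :
    ∑ k, (v ᵥ* S) k ^ 2 ≤ Lam * ∑ i, v i ^ 2 := by
  have := h.dotProduct_mulVec_nonneg v
  rw [star_trivial, sub_mulVec, dotProduct_sub, dotProduct_mul_transpose_mulVec, smul_mulVec,
    one_mulVec, dotProduct_smul, smul_eq_mul] at this
  simp only [dotProduct, ← sq] at this
  linarith

lemma posDef_of_elliptic {d m : ℕ} {S : Matrix (Fin d) (Fin m) ℝ} {lam : ℝ} (hlam : 0 < lam)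
    (h : (S * Sᵀ - lam • (1 : Matrix (Fin d) (Fin d) ℝ)).PosSemidef) : (S * Sᵀ).PosDef := by
  have h1 : (lam • (1 : Matrix (Fin d) (Fin d) ℝ)).PosDef := Matrix.PosDef.one.smul hlam
  have := Matrix.PosDef.posSemidef_add h h1
  rwa [sub_add_cancel] at this

/-- Whitening by a square root `A` of a matrix that is bounded below by `lam`. -/
lemma sum_sq_inv_mulVec_le {d m : ℕ} {S : Matrix (Fin d) (Fin m) ℝ} {lam : ℝ} (hlam : 0 < lam)
    (h : (S * Sᵀ - lam • (1 : Matrix (Fin d) (Fin d) ℝ)).PosSemidef)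
    {A : Matrix (Fin d) (Fin d) ℝ} (hA : IsUnit A.det) (hS : S * Sᵀ = A * Aᵀ) (u : Fin d → ℝ) :
    ∑ i, (A⁻¹ *ᵥ u) i ^ 2 ≤ (∑ i, u i ^ 2) / lam := by
  set c := A⁻¹ *ᵥ u with hc
  -- Duality: ‖c‖² = ⟨v, u⟩ and lam‖v‖² ≤ ‖c‖² by ellipticity, so Cauchy–Schwarz gives lam‖c‖⁴ ≤
  -- ‖c‖²‖u‖².
  set v := c ᵥ* A⁻¹ with hv
  have hvA : v ᵥ* A = c := by rw [hv, vecMul_vecMul, nonsing_inv_mul _ hA, vecMul_one]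
  rw [hS] at h
  have h1 := mul_sum_sq_le_of_elliptic h v
  rw [hvA] at h1
  have h2 : ∑ i, c i ^ 2 = ∑ i, v i * u i := by
    have : c ⬝ᵥ c = v ⬝ᵥ u := by
      conv_lhs => rw [hc]
      rw [dotProduct_mulVec, ← hc]
    simpa [dotProduct, sq] using this
  have h3 := Finset.sum_mul_sq_le_sq_mul_sq Finset.univ v u
  rw [← h2] at h3
  set q := ∑ i, c i ^ 2
  have hq : 0 ≤ q := Finset.sum_nonneg fun i _ => sq_nonneg _
  have hu : 0 ≤ ∑ i, u i ^ 2 := Finset.sum_nonneg fun i _ => sq_nonneg _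
  rw [le_div_iff₀ hlam]
  rcases hq.eq_or_lt with h0 | h0
  · rw [← h0]; simpa using hu
  · have : q * (q * lam) ≤ q * ∑ i, u i ^ 2 := by nlinarith
    exact le_of_mul_le_mul_left this h0

/-- The reverse triangle inequality. Applied to whitened rows it compares standard deviations
directly with S₁ - S₂, so that no estimate on matrix square roots is needed. -/
lemma sqrt_sum_sq_sub_sqrt_sum_sq_sq_le {m : ℕ} (p q : Fin m → ℝ) :
    (√(∑ k, p k ^ 2) - √(∑ k, q k ^ 2)) ^ 2 ≤ ∑ k, (p k - q k) ^ 2 := by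
  have h := abs_norm_sub_norm_le (WithLp.toLp 2 p : EuclideanSpace ℝ (Fin m)) (WithLp.toLp 2 q)
  have h2 := pow_le_pow_left₀ (abs_nonneg _) h 2
  rw [sq_abs, EuclideanSpace.real_norm_sq_eq] at h2
  simpa [EuclideanSpace.norm_eq] using h2

/-- From log s ≥ 1 - 1/s. The variance part of the divergence thus becomes quadratic in s - 1, the
scale on which a Hilbert–Schmidt norm can control it. -/
lemma neg_log_add_half_sq_sub_one_le {s r : ℝ} (hs : 0 < s) (hr : 1 / s ≤ r) :
    -Real.log s + (s ^ 2 - 1) / 2 ≤ (1 / 2 + r) * (s - 1) ^ 2 := by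
  have h1 := Real.one_sub_inv_le_log_of_pos hs
  have h2 : (1 / 2 + 1 / s) * (s - 1) ^ 2 ≤ (1 / 2 + r) * (s - 1) ^ 2 :=
    mul_le_mul_of_nonneg_right (by linarith) (sq_nonneg _)
  have h3 : (1 / 2 + 1 / s) * (s - 1) ^ 2 = (s ^ 2 - 1) / 2 - (1 - s⁻¹) := by
    field_simp
    ring
  linarith

/-- A Donsker–Varadhan bound between two nondegenerate Gaussian laws with different means and
covariances. -/
theorem dvBound_gaussian_affine {d m : ℕ} {S₁ S₂ : Matrix (Fin d) (Fin m) ℝ} {lam Lam h : ℝ}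
    (hlam : 0 < lam) (hLam : 0 < Lam) (hh : 0 < h)
    (he₁ : (S₁ * S₁ᵀ - lam • (1 : Matrix (Fin d) (Fin d) ℝ)).PosSemidef)
    (he₂ : (S₂ * S₂ᵀ - lam • (1 : Matrix (Fin d) (Fin d) ℝ)).PosSemidef)
    (hb₂ : (Lam • (1 : Matrix (Fin d) (Fin d) ℝ) - S₂ * S₂ᵀ).PosSemidef)
    (a₁ a₂ : EuclideanSpace ℝ (Fin d)) :
    DVBound
      ((stdGaussian (EuclideanSpace ℝ (Fin m))).map
        fun z => a₁ + √h • WithLp.toLp 2 (S₁ *ᵥ z.ofLp))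
      ((stdGaussian (EuclideanSpace ℝ (Fin m))).map
        fun z => a₂ + √h • WithLp.toLp 2 (S₂ *ᵥ z.ofLp))
      (‖a₁ - a₂‖ ^ 2 / (2 * lam * h) + (1 / 2 + Lam / lam) / lam * hsNormSq (S₁ - S₂)) := by
  obtain ⟨A, μ, hA, hS₂, hS₁⟩ := exists_simultaneous_diagonalization
    (posDef_of_elliptic hlam he₁).isHermitian (posDef_of_elliptic hlam he₂)
  have hh' : 0 < √h := Real.sqrt_pos.2 hh
  -- the whitened rows
  have hrow : ∀ i, (∑ k, (A⁻¹ * S₁) i k ^ 2 = μ i) ∧ (∑ k, (A⁻¹ * S₂) i k ^ 2 = 1) := by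
    intro i
    have key : ∀ S : Matrix (Fin d) (Fin m) ℝ,
        ∑ k, (A⁻¹ * S) i k ^ 2 = (A⁻¹ * (S * Sᵀ) * (A⁻¹)ᵀ) i i := by
      intro S
      have : A⁻¹ * (S * Sᵀ) * (A⁻¹)ᵀ = (A⁻¹ * S) * (A⁻¹ * S)ᵀ := by
        rw [transpose_mul]; simp only [Matrix.mul_assoc]
      rw [this, Matrix.mul_apply]
      simp [sq]
    have hAt : IsUnit Aᵀ.det := by rwa [det_transpose]
    constructor
    · rw [key, hS₁, transpose_nonsing_inv, Matrix.mul_assoc A,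
        nonsing_inv_mul_cancel_left _ _ hA, mul_nonsing_inv_cancel_right _ _ hAt]
      simp
    · rw [key, hS₂, transpose_nonsing_inv, Matrix.mul_assoc,
        mul_nonsing_inv_cancel_right _ _ hAt, nonsing_inv_mul _ hA]
      simp
  have hvec : ∀ (S : Matrix (Fin d) (Fin m) ℝ) i k, (A⁻¹ * S) i k = ((A⁻¹ i) ᵥ* S) k :=
    fun S i k => by simp [Matrix.mul_apply, vecMul, dotProduct]
  -- With w the squared norm of row i of A⁻¹, lam·w ≤ μ i and 1 ≤ Lam·w, hence μ i ≥ lam/Lam. Since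
  -- lam/Lam ≤ 1, its square root is at least lam/Lam too.
  have hμ : ∀ i, 0 < μ i ∧ 1 / √(μ i) ≤ Lam / lam := by
    intro i
    have h1 := mul_sum_sq_le_of_elliptic he₁ (A⁻¹ i)
    have h2 := mul_sum_sq_le_of_elliptic he₂ (A⁻¹ i)
    have h3 := sum_sq_le_mul_of_bounded hb₂ (A⁻¹ i)
    simp only [← hvec] at h1 h2 h3
    rw [(hrow i).1] at h1
    rw [(hrow i).2] at h2 h3
    set w := ∑ j, A⁻¹ i j ^ 2
    have hw : 0 < w := by
      by_contra! hw
      nlinarith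
    have hμpos : 0 < μ i := (mul_pos hlam hw).trans_le h1
    have hll : lam ≤ Lam := by
      have : lam * w ≤ Lam * w := h2.trans h3
      exact le_of_mul_le_mul_right this hw
    refine ⟨hμpos, ?_⟩
    have hs : lam / Lam ≤ √(μ i) := by
      refine Real.le_sqrt_of_sq_le ?_
      have h4 : lam / Lam ≤ 1 := (div_le_one hLam).2 hll
      have h5 : 0 < lam / Lam := by positivity
      have h6 : lam / Lam ≤ μ i := by
        rw [div_le_iff₀ hLam]
        nlinarith
      nlinarith
    rw [one_div, ← inv_div]
    exact inv_anti₀ (by positivity) hs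
  set s : Fin d → ℝ := fun i => √(μ i) with hs
  have hspos : ∀ i, 0 < s i := fun i => Real.sqrt_pos.2 (hμ i).1
  set c : Fin d → ℝ := fun i => (A⁻¹ *ᵥ (a₁ - a₂).ofLp) i / √h with hc
  -- `T` undoes the whitening: it sends the standard Gaussian to the second law and a product of N(c
  -- i, s i²) to the first, so data processing reduces the claim to independent coordinates.
  let T : (Fin d → ℝ) → EuclideanSpace ℝ (Fin d) := fun z => a₂ + √h • WithLp.toLp 2 (A *ᵥ z)
  have hT : Measurable T := by
    have : Continuous T := by fun_prop
    exact this.measurable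
  have hfac : ∀ (k : ℕ) (S : Matrix (Fin d) (Fin k) ℝ) (a : EuclideanSpace ℝ (Fin d)),
      (stdGaussian (EuclideanSpace ℝ (Fin k))).map
        (fun z => a + √h • WithLp.toLp 2 (S *ᵥ z.ofLp)) =
      ((stdGaussian (EuclideanSpace ℝ (Fin k))).map
        (fun z => WithLp.toLp 2 (S *ᵥ z.ofLp))).map (fun w => a + √h • w) := by
    intro k S a
    have hcont : Continuous fun z : EuclideanSpace ℝ (Fin k) => WithLp.toLp 2 (S *ᵥ z.ofLp) := by
      fun_prop
    rw [Measure.map_map (by fun_prop) hcont.measurable]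
    rfl
  have htoLp : Measurable (WithLp.toLp 2 : (Fin d → ℝ) → EuclideanSpace ℝ (Fin d)) := by fun_prop
  have hlaw₂ : (stdGaussian (EuclideanSpace ℝ (Fin m))).map
        (fun z => a₂ + √h • WithLp.toLp 2 (S₂ *ᵥ z.ofLp)) =
      (Measure.pi fun _ : Fin d => gaussianReal 0 1).map T := by
    rw [hfac, map_mulVec_stdGaussian_eq hS₂, ← hfac, ← map_pi_eq_stdGaussian,
      Measure.map_map (Continuous.measurable (by fun_prop)) htoLp]
    rfl
  have hlaw₁ : (stdGaussian (EuclideanSpace ℝ (Fin m))).map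
        (fun z => a₁ + √h • WithLp.toLp 2 (S₁ *ᵥ z.ofLp)) =
      (Measure.pi fun i => gaussianReal (c i) (s i ^ 2).toNNReal).map T := by
    -- Only the covariance matters for the law, so S₁ may be replaced by the square factor
    -- A·diag(s).
    have hroot : S₁ * S₁ᵀ = (A * diagonal s) * (A * diagonal s)ᵀ := by
      rw [transpose_mul, diagonal_transpose, Matrix.mul_assoc A, ← Matrix.mul_assoc (diagonal s),
        diagonal_mul_diagonal, hS₁, ← Matrix.mul_assoc]
      congr 3
      funext i
      exact (Real.mul_self_sqrt (hμ i).1.le).symm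
    rw [hfac, map_mulVec_stdGaussian_eq hroot, ← hfac, ← map_pi_eq_stdGaussian,
      Measure.map_map (Continuous.measurable (by fun_prop)) htoLp, pi_gaussianReal_eq_map,
      Measure.map_map hT (Continuous.measurable (by fun_prop))]
    congr 1
    funext z
    simp only [Function.comp_apply, T]
    have e1 : (fun i => c i + s i * z i) = c + diagonal s *ᵥ z := by
      funext i; simp [mulVec_diagonal]
    have e2 : √h • (A *ᵥ c) = (a₁ - a₂).ofLp := by
      have : c = (√h)⁻¹ • (A⁻¹ *ᵥ (a₁ - a₂).ofLp) := by
        funext i; simp [hc, div_eq_inv_mul]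
      rw [this, mulVec_smul, mulVec_mulVec, mul_nonsing_inv _ hA, one_mulVec, smul_smul,
        mul_inv_cancel₀ hh'.ne', one_smul]
    rw [e1, mulVec_add, mulVec_mulVec, WithLp.toLp_add, smul_add,
      ← WithLp.toLp_smul 2 (√h) (A *ᵥ c), e2]
    simp only [WithLp.toLp_ofLp]
    abel
  rw [hlaw₁, hlaw₂]
  refine ((DVBound.pi fun i => dvBound_gaussianReal (hspos i) (c i)).map hT).mono ?_
  have hmean : ∑ i, c i ^ 2 / 2 ≤ ‖a₁ - a₂‖ ^ 2 / (2 * lam * h) := by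
    have h1 := sum_sq_inv_mulVec_le hlam he₂ hA hS₂ (a₁ - a₂).ofLp
    have h2 : ∑ i, c i ^ 2 / 2 = (∑ i, (A⁻¹ *ᵥ (a₁ - a₂).ofLp) i ^ 2) / (2 * h) := by
      rw [Finset.sum_div]
      refine Finset.sum_congr rfl fun i _ => ?_
      simp only [hc, div_pow, Real.sq_sqrt hh.le]
      field_simp
    rw [h2, EuclideanSpace.real_norm_sq_eq]
    calc _ ≤ (∑ i, (a₁ - a₂).ofLp i ^ 2) / lam / (2 * h) := by gcongr
      _ = _ := by field_simp
  -- The rows of A⁻¹S₁ and A⁻¹S₂ have norms s i and 1; after the reverse triangle inequality, the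
  -- whitening bound is applied column by column.
  have hcov : ∑ i, (s i - 1) ^ 2 ≤ hsNormSq (S₁ - S₂) / lam := by
    calc ∑ i, (s i - 1) ^ 2 ≤ ∑ i, ∑ k, ((A⁻¹ * (S₁ - S₂)) i k) ^ 2 := by
          refine Finset.sum_le_sum fun i _ => ?_
          have := sqrt_sum_sq_sub_sqrt_sum_sq_sq_le ((A⁻¹ * S₁) i) ((A⁻¹ * S₂) i)
          rw [(hrow i).1, (hrow i).2, Real.sqrt_one] at this
          simpa [Matrix.mul_sub] using this
      _ = ∑ k, ∑ i, (A⁻¹ *ᵥ fun j => (S₁ - S₂) j k) i ^ 2 := by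
          rw [Finset.sum_comm]
          simp [Matrix.mul_apply, mulVec, dotProduct]
      _ ≤ ∑ k, (∑ j, (S₁ - S₂) j k ^ 2) / lam :=
          Finset.sum_le_sum fun k _ => sum_sq_inv_mulVec_le hlam he₂ hA hS₂ _
      _ = hsNormSq (S₁ - S₂) / lam := by
          rw [← Finset.sum_div, hsNormSq, Finset.sum_comm]
  have hr : 0 ≤ 1 / 2 + Lam / lam := by positivity
  calc ∑ i, (-Real.log (s i) + (s i ^ 2 - 1 + c i ^ 2) / 2)
      ≤ ∑ i, (c i ^ 2 / 2 + (1 / 2 + Lam / lam) * (s i - 1) ^ 2) := by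
        refine Finset.sum_le_sum fun i _ => ?_
        have := neg_log_add_half_sq_sub_one_le (hspos i) (hμ i).2
        linarith
    _ = ∑ i, c i ^ 2 / 2 + (1 / 2 + Lam / lam) * ∑ i, (s i - 1) ^ 2 := by
        rw [Finset.sum_add_distrib, Finset.mul_sum]
    _ ≤ ‖a₁ - a₂‖ ^ 2 / (2 * lam * h) + (1 / 2 + Lam / lam) * (hsNormSq (S₁ - S₂) / lam) := by
        gcongr
    _ = _ := by ring

end GaussianKernel

end MultNoise

namespace MultNoise

/-! ### Contraction, regularity and shifted composition for one step. -/

section OneStep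

variable {d m : ℕ}

/-- One step of the Euler scheme with frozen coefficients `b₀`, `σ₀`. -/
noncomputable def eulerStep (b₀ : EuclideanSpace ℝ (Fin d) → EuclideanSpace ℝ (Fin d))
    (σ₀ : EuclideanSpace ℝ (Fin d) → Matrix (Fin d) (Fin m) ℝ) (h : ℝ)
    (x : EuclideanSpace ℝ (Fin d)) (z : EuclideanSpace ℝ (Fin m)) : EuclideanSpace ℝ (Fin d) :=
  x + h • b₀ x + √h • WithLp.toLp 2 ((σ₀ x).mulVec z.ofLp)

lemma hsNormSq_nonneg (A : Matrix (Fin d) (Fin m) ℝ) : 0 ≤ hsNormSq A :=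
  Finset.sum_nonneg fun _ _ => Finset.sum_nonneg fun _ _ => sq_nonneg _

lemma integral_sq_add_inner_stdGaussian (a : ℝ) (v : EuclideanSpace ℝ (Fin m)) :
    Integrable (fun z => (a + inner ℝ v z) ^ 2) (stdGaussian (EuclideanSpace ℝ (Fin m))) ∧
      ∫ z, (a + inner ℝ v z) ^ 2 ∂(stdGaussian (EuclideanSpace ℝ (Fin m))) = a ^ 2 + ‖v‖ ^ 2 := by
  set γ := stdGaussian (EuclideanSpace ℝ (Fin m))
  have hmem : MemLp (fun z => innerSL ℝ v z) 2 γ := IsGaussian.memLp_dual γ (innerSL ℝ v) 2 (by simp)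
  have hint : Integrable (fun z => innerSL ℝ v z) γ := hmem.integrable (by simp)
  have hmean : ∫ z, innerSL ℝ v z ∂γ = 0 := integral_strongDual_stdGaussian _
  have hvar : ∫ z, (innerSL ℝ v z) ^ 2 ∂γ = ‖v‖ ^ 2 := by
    have := variance_dual_stdGaussian (E := EuclideanSpace ℝ (Fin m)) (innerSL ℝ v)
    rw [variance_eq_integral (by fun_prop), hmean] at this
    simpa using this
  have hsq := hmem.integrable_sq
  simp only [innerSL_apply_apply] at *
  refine ⟨((memLp_const a).add hmem).integrable_sq, ?_⟩
  have h2 : Integrable (fun z => a ^ 2 + 2 * a * inner ℝ v z) γ :=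
    (integrable_const _).add (hint.const_mul _)
  have e : ∀ z, (a + inner ℝ v z) ^ 2 = (a ^ 2 + 2 * a * inner ℝ v z) + (inner ℝ v z) ^ 2 :=
    fun z => by ring
  rw [integral_congr_ae (ae_of_all _ e), integral_add h2 hsq,
    integral_add (integrable_const _) (hint.const_mul _), integral_const_mul, hmean, hvar]
  simp

lemma integral_norm_sq_add_mulVec_stdGaussian (a : EuclideanSpace ℝ (Fin d))
    (A : Matrix (Fin d) (Fin m) ℝ) {h : ℝ} (hh : 0 ≤ h) :
    Integrable (fun z => ‖a + √h • WithLp.toLp 2 (A.mulVec z.ofLp)‖ ^ 2)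
        (stdGaussian (EuclideanSpace ℝ (Fin m))) ∧
      ∫ z, ‖a + √h • WithLp.toLp 2 (A.mulVec z.ofLp)‖ ^ 2
        ∂(stdGaussian (EuclideanSpace ℝ (Fin m))) = ‖a‖ ^ 2 + h * hsNormSq A := by
  have e : ∀ z : EuclideanSpace ℝ (Fin m), ‖a + √h • WithLp.toLp 2 (A.mulVec z.ofLp)‖ ^ 2 =
      ∑ i, (a i + inner ℝ (√h • WithLp.toLp 2 (A i)) z) ^ 2 := by
    intro z
    rw [EuclideanSpace.real_norm_sq_eq]
    refine Finset.sum_congr rfl fun i _ => ?_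
    rw [real_inner_smul_left, EuclideanSpace.inner_eq_star_dotProduct]
    simp [Matrix.mulVec, dotProduct_comm]
  simp_rw [e]
  refine ⟨integrable_finsetSum _ fun i _ => (integral_sq_add_inner_stdGaussian _ _).1, ?_⟩
  rw [integral_finsetSum _ fun i _ => (integral_sq_add_inner_stdGaussian _ _).1]
  simp_rw [(integral_sq_add_inner_stdGaussian _ _).2, norm_smul, mul_pow, Real.norm_eq_abs, sq_abs,
    Real.sq_sqrt hh, EuclideanSpace.real_norm_sq_eq]
  rw [Finset.sum_add_distrib, ← Finset.mul_sum]
  rfl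

variable {b : ℝ → EuclideanSpace ℝ (Fin d) → EuclideanSpace ℝ (Fin d)}
  {σ : ℝ → EuclideanSpace ℝ (Fin d) → Matrix (Fin d) (Fin m) ℝ} {T α lam β Lam : ℝ}

/-- Monotonicity leaves ½‖σ(x) - σ(y)‖² ≤ -α‖x - y‖² - ⟨b(x) - b(y), x - y⟩, and the inner product
is at least -β‖x - y‖². Lipschitz continuity of σ is therefore a consequence, not an assumption. -/
lemma hsNormSq_sub_le (hM : MonotoneElliptic b σ T α lam) (hL : LipschitzBounded b σ T β Lam)
    {t : ℝ} (ht : t ∈ Set.Icc 0 T) (x y : EuclideanSpace ℝ (Fin d)) :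
    hsNormSq (σ t x - σ t y) ≤ 2 * (β - α) * ‖x - y‖ ^ 2 := by
  have h1 := hM.monotone t ht x y
  have h2 := hL.lipschitz t ht x y
  have h3 := abs_le.1 (abs_real_inner_le_norm (b t x - b t y) (x - y))
  have h4 : ‖b t x - b t y‖ * ‖x - y‖ ≤ β * ‖x - y‖ * ‖x - y‖ :=
    mul_le_mul_of_nonneg_right h2 (norm_nonneg _)
  nlinarith [h3.1]

lemma alpha_le_beta (hM : MonotoneElliptic b σ T α lam) (hL : LipschitzBounded b σ T β Lam)
    (hT : 0 ≤ T) {x y : EuclideanSpace ℝ (Fin d)} (hxy : x ≠ y) : α ≤ β := by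
  have h1 := hsNormSq_sub_le hM hL (Set.left_mem_Icc.2 hT) x y
  have h2 := hsNormSq_nonneg (σ 0 x - σ 0 y)
  have h3 : 0 < ‖x - y‖ ^ 2 := by
    have := norm_pos_iff.2 (sub_ne_zero.2 hxy)
    positivity
  by_contra! h
  nlinarith

lemma lam_le_Lam (hM : MonotoneElliptic b σ T α lam) (hL : LipschitzBounded b σ T β Lam)
    (hT : 0 ≤ T) {x y : EuclideanSpace ℝ (Fin d)} (hxy : x ≠ y) : lam ≤ Lam := by
  have h1 := mul_sum_sq_le_of_elliptic (hM.elliptic 0 (Set.left_mem_Icc.2 hT) x) (x - y).ofLp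
  have h2 := sum_sq_le_mul_of_bounded (hL.bounded 0 (Set.left_mem_Icc.2 hT) x) (x - y).ofLp
  rw [← EuclideanSpace.real_norm_sq_eq] at h1 h2
  have h3 : 0 < ‖x - y‖ ^ 2 := by
    have := norm_pos_iff.2 (sub_ne_zero.2 hxy)
    positivity
  exact le_of_mul_le_mul_right (h1.trans h2) h3

lemma continuous_eulerStep (hM : MonotoneElliptic b σ T α lam) (hL : LipschitzBounded b σ T β Lam)
    {t : ℝ} (ht : t ∈ Set.Icc 0 T) (h : ℝ) :
    Continuous fun p : EuclideanSpace ℝ (Fin d) × EuclideanSpace ℝ (Fin m) =>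
      eulerStep (b t) (σ t) h p.1 p.2 := by
  have hb : Continuous (b t) := by
    refine (LipschitzWith.of_dist_le_mul (K := β.toNNReal) fun x y => ?_).continuous
    rw [Real.coe_toNNReal _ hL.beta_pos.le, dist_eq_norm, dist_eq_norm]
    exact hL.lipschitz t ht x y
  have hσ : Continuous (σ t) := by
    refine continuous_matrix fun i j => ?_
    refine (LipschitzWith.of_dist_le_mul (K := (√(2 * (β - α))).toNNReal)
      fun x y => ?_).continuous
    rw [Real.coe_toNNReal _ (Real.sqrt_nonneg _), Real.dist_eq, dist_eq_norm]
    have h1 := hsNormSq_sub_le hM hL ht x y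
    have h2 : (σ t x i j - σ t y i j) ^ 2 ≤ hsNormSq (σ t x - σ t y) := by
      refine le_trans ?_ (Finset.single_le_sum (f := fun i => ∑ j, (σ t x - σ t y) i j ^ 2)
        (fun i _ => Finset.sum_nonneg fun j _ => sq_nonneg _) (Finset.mem_univ i))
      exact Finset.single_le_sum (f := fun j => (σ t x - σ t y) i j ^ 2)
        (fun j _ => sq_nonneg _) (Finset.mem_univ j)
    rw [← Real.sqrt_sq (norm_nonneg (x - y)), ← Real.sqrt_mul' _ (sq_nonneg _)]
    exact Real.abs_le_sqrt (h2.trans h1)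
  unfold eulerStep
  have h1 : Continuous fun p : EuclideanSpace ℝ (Fin d) × EuclideanSpace ℝ (Fin m) =>
      (σ t p.1).mulVec p.2.ofLp :=
    (hσ.comp continuous_fst).matrix_mulVec (by fun_prop)
  fun_prop

/-- In the expanded square, the cross term and the noise term together are exactly 2h times the left
side of the monotonicity condition. -/
lemma norm_sq_drift_sub_le (hM : MonotoneElliptic b σ T α lam) (hL : LipschitzBounded b σ T β Lam)
    {t : ℝ} (ht : t ∈ Set.Icc 0 T) {h : ℝ} (hh : 0 < h) (x y : EuclideanSpace ℝ (Fin d)) :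
    ‖(x + h • b t x) - (y + h • b t y)‖ ^ 2 + h * hsNormSq (σ t x - σ t y) ≤
      (1 - 2 * α * h + β ^ 2 * h ^ 2) * ‖x - y‖ ^ 2 := by
  have e : (x + h • b t x) - (y + h • b t y) = (x - y) + h • (b t x - b t y) := by
    rw [smul_sub]; abel
  rw [e, norm_add_sq_real, real_inner_smul_right, norm_smul, mul_pow, Real.norm_eq_abs, sq_abs,
    real_inner_comm]
  have h1 := hM.monotone t ht x y
  have h2 : ‖b t x - b t y‖ ^ 2 ≤ β ^ 2 * ‖x - y‖ ^ 2 := by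
    rw [← mul_pow]
    exact pow_le_pow_left₀ (norm_nonneg _) (hL.lipschitz t ht x y) 2
  nlinarith [mul_le_mul_of_nonneg_left h1 hh.le, mul_le_mul_of_nonneg_left h2 (sq_nonneg h)]

/-- Mean-square contraction of one Euler step under the synchronous coupling. -/
lemma integral_norm_sq_eulerStep_sub_le (hM : MonotoneElliptic b σ T α lam)
    (hL : LipschitzBounded b σ T β Lam) {t : ℝ} (ht : t ∈ Set.Icc 0 T) {h : ℝ} (hh : 0 < h)
    (x y : EuclideanSpace ℝ (Fin d)) :
    Integrable (fun z => ‖eulerStep (b t) (σ t) h x z - eulerStep (b t) (σ t) h y z‖ ^ 2)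
        (stdGaussian (EuclideanSpace ℝ (Fin m))) ∧
      ∫ z, ‖eulerStep (b t) (σ t) h x z - eulerStep (b t) (σ t) h y z‖ ^ 2
        ∂(stdGaussian (EuclideanSpace ℝ (Fin m))) ≤
        (1 - 2 * α * h + β ^ 2 * h ^ 2) * ‖x - y‖ ^ 2 := by
  have e : ∀ z : EuclideanSpace ℝ (Fin m),
      eulerStep (b t) (σ t) h x z - eulerStep (b t) (σ t) h y z =
        ((x + h • b t x) - (y + h • b t y)) +
          √h • WithLp.toLp 2 ((σ t x - σ t y).mulVec z.ofLp) := by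
    intro z
    rw [Matrix.sub_mulVec, WithLp.toLp_sub, smul_sub, eulerStep, eulerStep]
    abel
  simp_rw [e]
  obtain ⟨h1, h2⟩ := integral_norm_sq_add_mulVec_stdGaussian
    ((x + h • b t x) - (y + h • b t y)) (σ t x - σ t y) hh.le
  exact ⟨h1, h2.trans_le (norm_sq_drift_sub_le hM hL ht hh x y)⟩

/-- The regularity constant of one Euler step. -/
noncomputable def stepConst (α lam β Lam h : ℝ) : ℝ :=
  (1 - 2 * α * h + β ^ 2 * h ^ 2) / (2 * lam * h) + 2 * (β - α) * (Lam / lam) ^ 3 / lam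

lemma dvBound_eulerStep (hM : MonotoneElliptic b σ T α lam) (hL : LipschitzBounded b σ T β Lam)
    {t : ℝ} (ht : t ∈ Set.Icc 0 T) {h : ℝ} (hh : 0 < h) (x y : EuclideanSpace ℝ (Fin d)) :
    DVBound ((stdGaussian (EuclideanSpace ℝ (Fin m))).map (eulerStep (b t) (σ t) h x))
      ((stdGaussian (EuclideanSpace ℝ (Fin m))).map (eulerStep (b t) (σ t) h y))
      (stepConst α lam β Lam h * ‖x - y‖ ^ 2) := by
  -- The comparison lam ≤ Lam is read off from two distinct points; for d = 0 there are none.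
  rcases eq_or_ne x y with rfl | hxy
  · have hc : Measurable (eulerStep (b t) (σ t) h x) :=
      ((continuous_eulerStep hM hL ht h).comp (Continuous.prodMk_right x)).measurable
    have := Measure.isProbabilityMeasure_map (μ := stdGaussian (EuclideanSpace ℝ (Fin m)))
      hc.aemeasurable
    simpa using DVBound.refl ((stdGaussian (EuclideanSpace ℝ (Fin m))).map
      (eulerStep (b t) (σ t) h x))
  have hT : 0 ≤ T := ht.1.trans ht.2
  have hlam := hM.lam_pos
  have hLam := hL.Lam_pos
  refine (dvBound_gaussian_affine hlam hLam hh (hM.elliptic t ht x)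
    (hM.elliptic t ht y) (hL.bounded t ht y) (x + h • b t x) (y + h • b t y)).mono ?_
  have h1 := norm_sq_drift_sub_le hM hL ht hh x y
  have h2 := hsNormSq_sub_le hM hL ht x y
  have h3 := hsNormSq_nonneg (σ t x - σ t y)
  have hr : 1 ≤ Lam / lam := (one_le_div hlam).2 (lam_le_Lam hM hL hT hxy)
  have hr3 : Lam / lam ≤ (Lam / lam) ^ 3 := le_self_pow₀ hr (by norm_num)
  set H := hsNormSq (σ t x - σ t y)
  set D := ‖(x + h • b t x) - (y + h • b t y)‖ ^ 2
  set r := Lam / lam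
  -- The summand 1/2 of the covariance cost joins the drift cost to form D + hH, which contraction
  -- bounds by L²‖x - y‖². Only r·H/lam is left, and r ≤ r³ brings it to the form of `stepConst`.
  calc D / (2 * lam * h) + (1 / 2 + r) / lam * H
      = (D + h * H) / (2 * lam * h) + r * H / lam := by field_simp; ring
    _ ≤ ((1 - 2 * α * h + β ^ 2 * h ^ 2) * ‖x - y‖ ^ 2) / (2 * lam * h)
        + r ^ 3 * (2 * (β - α) * ‖x - y‖ ^ 2) / lam := by
        gcongr
    _ = stepConst α lam β Lam h * ‖x - y‖ ^ 2 := by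
        rw [stepConst]
        ring

/-- Expectation of `g` after one random step `s` from `x`. -/
noncomputable def transition {E F : Type*} [MeasurableSpace F] (γ : Measure F) (s : E → F → E)
    (g : E → ℝ) (x : E) : ℝ := ∫ z, g (s x z) ∂γ

lemma measurable_transition {E F : Type*} [MeasurableSpace E] [MeasurableSpace F] {γ : Measure F}
    [SFinite γ] {s : E → F → E} (hs : Measurable (Function.uncurry s)) {g : E → ℝ}
    (hg : Measurable g) : Measurable (transition γ s g) :=
  (StronglyMeasurable.integral_prod_right (f := fun x z => g (s x z))
    (hg.comp hs).stronglyMeasurable).measurable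

/-- One step of the shifted composition argument: the two starting points are first moved towards
each other at the price `C`, then coupled with mean-square contraction factor `L2`. -/
lemma transition_le_log_transition_exp {E F : Type*} [NormedAddCommGroup E] [NormedSpace ℝ E]
    [MeasurableSpace E] [MeasurableSpace F] {γ : Measure F} [IsProbabilityMeasure γ]
    {s : E → F → E} (hs : Measurable (Function.uncurry s)) {C L2 K : ℝ} (hC : 0 < C) (hL2 : 0 < L2)
    (hK : 0 ≤ K) (hDV : ∀ x y, DVBound (γ.map (s x)) (γ.map (s y)) (C * ‖x - y‖ ^ 2))
    (hcontr : ∀ x y, Integrable (fun z => ‖s x z - s y z‖ ^ 2) γ ∧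
      ∫ z, ‖s x z - s y z‖ ^ 2 ∂γ ≤ L2 * ‖x - y‖ ^ 2)
    {g F : E → ℝ} {M : ℝ} (hg : Measurable g) (hgM : ∀ x, |g x| ≤ M) (hF : Measurable F)
    (hFM : ∀ x, |F x| ≤ M) (hgF : ∀ x y, g x ≤ F y + K * ‖x - y‖ ^ 2) (x y : E) :
    transition γ s g x ≤ Real.log (transition γ s (fun w => Real.exp (F w)) y) +
      C * K * L2 / (C + K * L2) * ‖x - y‖ ^ 2 := by
  have hpos : 0 < C + K * L2 := by positivity
  have hsx : ∀ x, Measurable (s x) := fun x => hs.comp measurable_prodMk_left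
  -- This η minimises Cη² + K L2 (1 - η)², and the minimum is half the harmonic mean of C and K L2.
  set η := K * L2 / (C + K * L2) with hη
  set w := y + η • (x - y) with hw
  have hwy : ‖w - y‖ ^ 2 = η ^ 2 * ‖x - y‖ ^ 2 := by
    rw [hw, add_sub_cancel_left, norm_smul, mul_pow, Real.norm_eq_abs, sq_abs]
  have hxw : ‖x - w‖ ^ 2 = (1 - η) ^ 2 * ‖x - y‖ ^ 2 := by
    have : x - w = (1 - η) • (x - y) := by
      rw [hw, sub_smul, one_smul]; abel
    rw [this, norm_smul, mul_pow, Real.norm_eq_abs, sq_abs]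
  have hFi : Integrable (fun z => F (s w z)) γ :=
    integrable_of_abs_le (hF.comp (hsx w)) fun z => hFM _
  have h1 : transition γ s g x ≤ transition γ s F w + K * (L2 * ‖x - w‖ ^ 2) := by
    calc transition γ s g x ≤ ∫ z, (F (s w z) + K * ‖s x z - s w z‖ ^ 2) ∂γ := by
          refine integral_mono (integrable_of_abs_le (hg.comp (hsx x)) fun z => hgM _)
            (hFi.add ((hcontr x w).1.const_mul K)) fun z => hgF _ _
      _ = transition γ s F w + K * ∫ z, ‖s x z - s w z‖ ^ 2 ∂γ := by
          rw [integral_add hFi ((hcontr x w).1.const_mul K), integral_const_mul, transition]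
      _ ≤ _ := by
          gcongr
          exact (hcontr x w).2
  have h2 := hDV w y F M hF hFM
  rw [integral_map (hsx w).aemeasurable hF.aestronglyMeasurable,
    integral_map (hsx y).aemeasurable (by fun_prop)] at h2
  have h3 : transition γ s F w ≤ C * ‖w - y‖ ^ 2 +
      Real.log (transition γ s (fun w => Real.exp (F w)) y) := h2
  rw [hwy] at h3
  rw [hxw] at h1
  have h4 : C * η ^ 2 + K * L2 * (1 - η) ^ 2 = C * K * L2 / (C + K * L2) := by
    rw [hη]
    field_simp
    ring
  rw [← h4]
  linarith

end OneStep

end MultNoise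

namespace MultNoise

/-! ### Iteration along the Euler scheme. -/

section Scheme

variable {d m : ℕ} {b : ℝ → EuclideanSpace ℝ (Fin d) → EuclideanSpace ℝ (Fin d)}
  {σ : ℝ → EuclideanSpace ℝ (Fin d) → Matrix (Fin d) (Fin m) ℝ} {α lam β Lam : ℝ}
  {Ω : Type*} {ξ : ℕ → Ω → EuclideanSpace ℝ (Fin m)} {h : ℝ} {N : ℕ}

lemma euler_succ (x : EuclideanSpace ℝ (Fin d)) (n : ℕ) (ω : Ω) :
    euler b σ h ξ x (n + 1) ω =
      eulerStep (b (n * h)) (σ (n * h)) h (euler b σ h ξ x n ω) (ξ n ω) := rfl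

/-- The scheme after `n` steps is a measurable function of the first `n` noise vectors. -/
lemma exists_measurable_euler_eq
    (hstep : ∀ n < N, Measurable (Function.uncurry (eulerStep (b (n * h)) (σ (n * h)) h)))
    (x : EuclideanSpace ℝ (Fin d)) {n : ℕ} (hn : n ≤ N) :
    ∃ Φ : (Finset.range n → EuclideanSpace ℝ (Fin m)) → EuclideanSpace ℝ (Fin d),
      Measurable Φ ∧ ∀ ω, euler b σ h ξ x n ω = Φ fun i => ξ i ω := by
  induction n with
  | zero => exact ⟨fun _ => x, measurable_const, fun _ => rfl⟩
  | succ n ih =>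
    obtain ⟨Φ, hΦ, hΦe⟩ := ih (by omega)
    refine ⟨fun u => eulerStep (b (n * h)) (σ (n * h)) h
      (Φ fun i => u ⟨i, Finset.mem_range.2 ((Finset.mem_range.1 i.2).trans (Nat.lt_succ_self n))⟩)
      (u ⟨n, Finset.self_mem_range_succ n⟩), ?_, fun ω => ?_⟩
    · have h1 : Measurable fun u : Finset.range (n + 1) → EuclideanSpace ℝ (Fin m) =>
          Φ fun i => u ⟨i, Finset.mem_range.2
            ((Finset.mem_range.1 i.2).trans (Nat.lt_succ_self n))⟩ :=
        hΦ.comp (measurable_pi_lambda _ fun i => measurable_pi_apply _)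
      exact (hstep n (by omega)).comp (h1.prodMk (measurable_pi_apply _))
    · rw [euler_succ, hΦe]

variable [MeasurableSpace Ω] {P : Measure Ω}

lemma aemeasurable_euler
    (hstep : ∀ n < N, Measurable (Function.uncurry (eulerStep (b (n * h)) (σ (n * h)) h)))
    (hξ : ∀ n, AEMeasurable (ξ n) P) (x : EuclideanSpace ℝ (Fin d)) {n : ℕ} (hn : n ≤ N) :
    AEMeasurable (euler b σ h ξ x n) P := by
  obtain ⟨Φ, hΦ, hΦe⟩ := exists_measurable_euler_eq (ξ := ξ) hstep x hn
  rw [funext hΦe]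
  exact hΦ.comp_aemeasurable (aemeasurable_pi_lambda _ fun i => hξ i)

variable [IsProbabilityMeasure P]

/-- The Markov property: the state at step n depends only on earlier noise, hence is independent of
ξ n. -/
lemma integral_euler_succ
    (hstep : ∀ n < N, Measurable (Function.uncurry (eulerStep (b (n * h)) (σ (n * h)) h)))
    (hξ_indep : iIndepFun ξ P)
    (hξ_law : ∀ n, HasLaw (ξ n) (stdGaussian (EuclideanSpace ℝ (Fin m))) P)
    (x : EuclideanSpace ℝ (Fin d)) {n : ℕ} (hn : n < N) {g : EuclideanSpace ℝ (Fin d) → ℝ} {M : ℝ}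
    (hg : Measurable g) (hgM : ∀ x, |g x| ≤ M) :
    ∫ ω, g (euler b σ h ξ x (n + 1) ω) ∂P =
      ∫ ω, transition (stdGaussian (EuclideanSpace ℝ (Fin m)))
        (eulerStep (b (n * h)) (σ (n * h)) h) g (euler b σ h ξ x n ω) ∂P := by
  have hξ : ∀ n, AEMeasurable (ξ n) P := fun n => (hξ_law n).aemeasurable
  have hX := aemeasurable_euler hstep hξ x hn.le
  have hind : IndepFun (euler b σ h ξ x n) (ξ n) P := by
    obtain ⟨Φ, hΦ, hΦe⟩ := exists_measurable_euler_eq (ξ := ξ) hstep x hn.le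
    have := hξ_indep.indepFun_finset₀ (Finset.range n) {n} (by simp) hξ
    have h2 := this.comp hΦ (measurable_pi_apply (⟨n, Finset.mem_singleton_self n⟩ :
      ({n} : Finset ℕ)))
    rw [funext hΦe]
    exact h2
  have hgs : Measurable fun p : EuclideanSpace ℝ (Fin d) × EuclideanSpace ℝ (Fin m) =>
      g (eulerStep (b (n * h)) (σ (n * h)) h p.1 p.2) := hg.comp (hstep n hn)
  have := Measure.isProbabilityMeasure_map hX
  calc ∫ ω, g (euler b σ h ξ x (n + 1) ω) ∂P
      = ∫ p, g (eulerStep (b (n * h)) (σ (n * h)) h p.1 p.2)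
          ∂(P.map fun ω => (euler b σ h ξ x n ω, ξ n ω)) := by
        rw [integral_map (hX.prodMk (hξ n)) hgs.aestronglyMeasurable]
        rfl
    _ = ∫ p, g (eulerStep (b (n * h)) (σ (n * h)) h p.1 p.2)
          ∂((P.map (euler b σ h ξ x n)).prod (stdGaussian (EuclideanSpace ℝ (Fin m)))) := by
        rw [hind.map_prod_eq_prod_map_map hX (hξ n), (hξ_law n).map_eq]
    _ = ∫ w, transition (stdGaussian (EuclideanSpace ℝ (Fin m)))
          (eulerStep (b (n * h)) (σ (n * h)) h) g w ∂(P.map (euler b σ h ξ x n)) := by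
        rw [integral_prod _ (integrable_of_abs_le hgs fun p => hgM _)]
        rfl
    _ = _ := integral_map hX (measurable_transition (hstep n hn) hg).aestronglyMeasurable

lemma mul_step_mem_Icc (hh : 0 < h) {n : ℕ} (hn : n < N) {T : ℝ} (hT : N * h ≤ T) :
    (n : ℝ) * h ∈ Set.Icc 0 T := by
  refine ⟨by positivity, le_trans ?_ hT⟩
  have : (n : ℝ) ≤ N := by exact_mod_cast hn.le
  gcongr

lemma measurable_eulerStep_of_lt {T : ℝ} (hM : MonotoneElliptic b σ T α lam)
    (hL : LipschitzBounded b σ T β Lam) (hh : 0 < h) (hT : N * h ≤ T) :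
    ∀ n < N, Measurable (Function.uncurry (eulerStep (b (n * h)) (σ (n * h)) h)) :=
  fun _ hn => (continuous_eulerStep hM hL (mul_step_mem_Icc hh hn hT) h).measurable

/-- The Donsker–Varadhan inequality propagated backwards along the scheme; the cost constant
improves from `C / a j` to `C / a (j + n)` with `a j = ∑ i < j, L2⁻¹ ^ i`. -/
lemma integral_euler_le_log_integral_exp {T : ℝ} (hM : MonotoneElliptic b σ T α lam)
    (hL : LipschitzBounded b σ T β Lam) (hh : 0 < h) (hT : N * h ≤ T) (hξ_indep : iIndepFun ξ P)
    (hξ_law : ∀ n, HasLaw (ξ n) (stdGaussian (EuclideanSpace ℝ (Fin m))) P)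
    (hL2 : 0 < 1 - 2 * α * h + β ^ 2 * h ^ 2) (hC : 0 < stepConst α lam β Lam h)
    (x y : EuclideanSpace ℝ (Fin d)) {n : ℕ} (hn : n ≤ N) {j : ℕ} (hj : 1 ≤ j)
    {g F : EuclideanSpace ℝ (Fin d) → ℝ} {M : ℝ} (hg : Measurable g) (hgM : ∀ x, |g x| ≤ M)
    (hF : Measurable F) (hFM : ∀ x, |F x| ≤ M)
    (hgF : ∀ x y, g x ≤ F y + stepConst α lam β Lam h /
      (∑ i ∈ Finset.range j, (1 - 2 * α * h + β ^ 2 * h ^ 2)⁻¹ ^ i) * ‖x - y‖ ^ 2) :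
    ∫ ω, g (euler b σ h ξ x n ω) ∂P ≤
      Real.log (∫ ω, Real.exp (F (euler b σ h ξ y n ω)) ∂P) + stepConst α lam β Lam h /
        (∑ i ∈ Finset.range (j + n), (1 - 2 * α * h + β ^ 2 * h ^ 2)⁻¹ ^ i) * ‖x - y‖ ^ 2 := by
  set C := stepConst α lam β Lam h with hCdef
  set L2 := 1 - 2 * α * h + β ^ 2 * h ^ 2 with hL2def
  have hstep := measurable_eulerStep_of_lt hM hL hh hT
  -- The last step is absorbed into the test functions, g becoming Qg and F becoming log Q e^F,
  -- while j records how many steps have been absorbed.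
  induction n generalizing j g F with
  | zero => simpa [euler] using hgF x y
  | succ n ih =>
    have hn' : n < N := by omega
    have ht := mul_step_mem_Icc hh hn' hT
    set γ := stdGaussian (EuclideanSpace ℝ (Fin m))
    set s := eulerStep (b (n * h)) (σ (n * h)) h with hs
    have hsm := hstep n hn'
    have hexpM : ∀ w, |Real.exp (F w)| ≤ Real.exp M := fun w => by
      rw [Real.abs_exp]; exact Real.exp_le_exp.2 (abs_le.1 (hFM w)).2
    have hexpm : Measurable fun w => Real.exp (F w) := Real.measurable_exp.comp hF
    have hsx : ∀ w, Measurable (s w) := fun w => hsm.comp measurable_prodMk_left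
    have ha : 0 < ∑ i ∈ Finset.range j, L2⁻¹ ^ i :=
      Finset.sum_pos (fun i _ => by positivity) (Finset.nonempty_range_iff.2 (by omega))
    have hpos : ∀ w, 0 < transition γ s (fun w => Real.exp (F w)) w := fun w =>
      integral_exp_pos_of_abs_le (hF.comp (hsx w)) fun z => hFM _
    rw [integral_euler_succ hstep hξ_indep hξ_law x hn' hg hgM,
      integral_euler_succ hstep hξ_indep hξ_law y hn' hexpm hexpM]
    -- For K = C / a the recursion 1/K' = 1/C + 1/(L2 K) reads a' = L2⁻¹ a + 1, which generates
    -- geometric sums.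
    have hrec : C * (C / ∑ i ∈ Finset.range j, L2⁻¹ ^ i) * L2 /
        (C + (C / ∑ i ∈ Finset.range j, L2⁻¹ ^ i) * L2) =
        C / ∑ i ∈ Finset.range (j + 1), L2⁻¹ ^ i := by
      have e : ∑ i ∈ Finset.range (j + 1), L2⁻¹ ^ i =
          (∑ i ∈ Finset.range j, L2⁻¹ ^ i) * L2⁻¹ + 1 := by
        rw [Finset.sum_range_succ', Finset.sum_mul]
        simp [pow_succ]
      rw [e]
      set a := ∑ i ∈ Finset.range j, L2⁻¹ ^ i
      field_simp
    have hone := transition_le_log_transition_exp hsm hC hL2 (by positivity)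
      (dvBound_eulerStep hM hL ht hh) (integral_norm_sq_eulerStep_sub_le hM hL ht hh)
      hg hgM hF hFM hgF
    rw [hrec] at hone
    have := ih (by omega) (j := j + 1) (by omega) (g := transition γ s g)
      (F := fun w => Real.log (transition γ s (fun w => Real.exp (F w)) w))
      (measurable_transition hsm hg) (fun w => abs_integral_le_of_abs_le fun z => hgM _)
      (Real.measurable_log.comp (measurable_transition hsm hexpm))
      (fun w => abs_log_integral_exp_le (hF.comp (hsx w)) fun z => hFM _) hone
    simp only [Real.exp_log (hpos _)] at this
    rwa [show j + (n + 1) = j + 1 + n by ring]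

/-- Donsker–Varadhan bound between the laws of the scheme from two starting points. -/
theorem dvBound_euler {T : ℝ} (hM : MonotoneElliptic b σ T α lam)
    (hL : LipschitzBounded b σ T β Lam) (hh : 0 < h) (hN : 1 ≤ N) (hT : N * h ≤ T)
    (hξ_indep : iIndepFun ξ P)
    (hξ_law : ∀ n, HasLaw (ξ n) (stdGaussian (EuclideanSpace ℝ (Fin m))) P)
    (hL2 : 0 < 1 - 2 * α * h + β ^ 2 * h ^ 2) (x y : EuclideanSpace ℝ (Fin d)) :
    DVBound (P.map (euler b σ h ξ x N)) (P.map (euler b σ h ξ y N))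
      (stepConst α lam β Lam h /
        (∑ i ∈ Finset.range N, (1 - 2 * α * h + β ^ 2 * h ^ 2)⁻¹ ^ i) * ‖x - y‖ ^ 2) := by
  have hstep := measurable_eulerStep_of_lt hM hL hh hT
  have hX := fun x => aemeasurable_euler hstep (fun n => (hξ_law n).aemeasurable) x le_rfl
  rcases eq_or_ne x y with rfl | hxy
  · have := Measure.isProbabilityMeasure_map (hX x)
    simpa using DVBound.refl (P.map (euler b σ h ξ x N))
  have hT0 : 0 ≤ T := le_trans (by positivity) hT
  have hC : 0 < stepConst α lam β Lam h := by
    have h1 := sub_nonneg.2 (alpha_le_beta hM hL hT0 hxy)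
    have h2 := hM.lam_pos
    have h3 := hL.Lam_pos
    unfold stepConst
    positivity
  -- The final step uses regularity alone and supplies the initial inequality with K = C, that is j
  -- = 1; the other n steps raise the index to N.
  obtain ⟨n, rfl⟩ : ∃ n, N = n + 1 := ⟨N - 1, by omega⟩
  intro f M hf hfM
  have hn' : n < n + 1 := n.lt_succ_self
  have ht := mul_step_mem_Icc hh hn' hT
  have hsm := hstep n hn'
  set γ := stdGaussian (EuclideanSpace ℝ (Fin m))
  set s := eulerStep (b (n * h)) (σ (n * h)) h with hs
  have hexpM : ∀ w, |Real.exp (f w)| ≤ Real.exp M := fun w => by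
    rw [Real.abs_exp]; exact Real.exp_le_exp.2 (abs_le.1 (hfM w)).2
  have hexpm : Measurable fun w => Real.exp (f w) := Real.measurable_exp.comp hf
  have hsx : ∀ w, Measurable (s w) := fun w => hsm.comp measurable_prodMk_left
  have hpos : ∀ w, 0 < transition γ s (fun w => Real.exp (f w)) w := fun w =>
    integral_exp_pos_of_abs_le (hf.comp (hsx w)) fun z => hfM _
  rw [integral_map (hX x) hf.aestronglyMeasurable, integral_map (hX y) hexpm.aestronglyMeasurable,
    integral_euler_succ hstep hξ_indep hξ_law x hn' hf hfM,
    integral_euler_succ hstep hξ_indep hξ_law y hn' hexpm hexpM]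
  have := integral_euler_le_log_integral_exp hM hL hh hT hξ_indep hξ_law hL2 hC x y hn'.le
    (le_refl 1) (g := transition γ s f)
    (F := fun w => Real.log (transition γ s (fun w => Real.exp (f w)) w))
    (measurable_transition hsm hf) (fun w => abs_integral_le_of_abs_le fun z => hfM _)
    (Real.measurable_log.comp (measurable_transition hsm hexpm))
    (fun w => abs_log_integral_exp_le (hf.comp (hsx w)) fun z => hfM _) (fun x y => by
      have h2 := dvBound_eulerStep hM hL ht hh x y f M hf hfM
      rw [integral_map (hsx x).aemeasurable hf.aestronglyMeasurable,
        integral_map (hsx y).aemeasurable hexpm.aestronglyMeasurable] at h2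
      simp only [Finset.range_one, Finset.sum_singleton, pow_zero, div_one]
      rw [add_comm]
      exact h2)
  simp only [Real.exp_log (hpos _)] at this
  rwa [add_comm n 1, add_comm (_ * _)]

end Scheme

end MultNoise

namespace MultNoise

/-! ### Closed forms of the constant. -/

section Constants

variable {α lam β Lam h L : ℝ} {N : ℕ}

lemma stepConst_eq (hlam : 0 < lam) (hh : 0 < h) (hL : 0 < L)
    (hL2 : L ^ 2 = 1 - 2 * α * h + β ^ 2 * h ^ 2) :
    stepConst α lam β Lam h =
      (1 + 4 * (β - α) * (Lam / lam) ^ 3 * h / L ^ 2) * (L ^ 2 / (2 * lam * h)) := by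
  rw [stepConst, ← hL2]
  set r := Lam / lam
  field_simp
  ring

lemma inv_sq_pow_eq_zpow : ((L ^ 2)⁻¹) ^ N = L ^ (-(2 * (N : ℤ))) := by
  rw [zpow_neg, zpow_mul, zpow_natCast, inv_pow]
  norm_cast

/-- The numerator comes from 1 - L² = 2h(α - β²h/2), which enters through the denominator L⁻² - 1 of
the geometric sum. -/
lemma stepConst_div_geom_sum_eq (hlam : 0 < lam) (hh : 0 < h) (hL : 0 < L)
    (hL2 : L ^ 2 = 1 - 2 * α * h + β ^ 2 * h ^ 2) (hL1 : L ≠ 1) :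
    stepConst α lam β Lam h / ∑ i ∈ Finset.range N, ((L ^ 2)⁻¹) ^ i =
      (1 + 4 * (β - α) * (Lam / lam) ^ 3 * h / L ^ 2) *
        ((α - β ^ 2 * h / 2) / (lam * (L ^ (-(2 * (N : ℤ))) - 1))) := by
  have hsq : L ^ 2 ≠ 1 := fun h1 => hL1 ((pow_eq_one_iff_of_nonneg hL.le two_ne_zero).1 h1)
  have hq : (L ^ 2)⁻¹ ≠ 1 := fun h1 => hsq (inv_eq_one.1 h1)
  rw [geom_sum_eq hq, inv_sq_pow_eq_zpow, stepConst_eq hlam hh hL hL2]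
  have hα : α - β ^ 2 * h / 2 = (1 - L ^ 2) / (2 * h) := by
    rw [hL2]; field_simp; ring
  have hq' : (L ^ 2)⁻¹ - 1 = (1 - L ^ 2) / L ^ 2 := by field_simp
  rw [hα, hq', mul_div_assoc]
  congr 1
  rw [div_div_eq_mul_div, mul_comm lam, div_div, ← mul_assoc]
  have h1 : L ^ 2 / (2 * lam * h) * ((1 - L ^ 2) / L ^ 2) = (1 - L ^ 2) / (2 * h * lam) := by
    field_simp
  rw [h1, div_div, mul_right_comm]

lemma stepConst_div_geom_sum_eq_of_one (hlam : 0 < lam) (hh : 0 < h) (hN : 1 ≤ N)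
    (hL : L = 1) (hL2 : L ^ 2 = 1 - 2 * α * h + β ^ 2 * h ^ 2) :
    stepConst α lam β Lam h / ∑ i ∈ Finset.range N, ((L ^ 2)⁻¹) ^ i =
      (1 + 4 * (β - α) * (Lam / lam) ^ 3 * h / L ^ 2) * (1 / (2 * lam * (N * h))) := by
  rw [stepConst_eq hlam hh (hL ▸ one_pos) hL2, mul_div_assoc]
  congr 1
  have : (N : ℝ) ≠ 0 := by positivity
  subst hL
  simp
  field_simp

end Constants

/-! ### Passage to the limit of vanishing step size. -/

section Limit

/-- For f bounded and continuous so is e^f, hence both sides of the inequality converge; such f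
suffice by `DVBound.of_boundedContinuous`. -/
lemma DVBound.of_weaklyTendsto {d : ℕ} {ρ θ : ℕ → Measure (EuclideanSpace ℝ (Fin d))}
    {μ ν : Measure (EuclideanSpace ℝ (Fin d))} [IsProbabilityMeasure μ] [IsProbabilityMeasure ν]
    (hμ : WeaklyTendsto ρ μ) (hν : WeaklyTendsto θ ν) {B : ℕ → ℝ} {C : ℝ}
    (hB : Tendsto B atTop (𝓝 C)) (h : ∀ᶠ k in atTop, DVBound (ρ k) (θ k) (B k)) :
    DVBound μ ν C := by
  refine DVBound.of_boundedContinuous fun f => ?_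
  have hfM : ∀ x, |f x| ≤ ‖f‖ := f.norm_coe_le_norm
  let e : EuclideanSpace ℝ (Fin d) →ᵇ ℝ :=
    BoundedContinuousFunction.ofNormedAddCommGroup (fun x => Real.exp (f x)) (by fun_prop)
      (Real.exp ‖f‖) fun x => by
        rw [Real.norm_eq_abs, Real.abs_exp]
        exact Real.exp_le_exp.2 ((le_abs_self _).trans (hfM x))
  have he : Tendsto (fun k => ∫ z, Real.exp (f z) ∂(θ k)) atTop (𝓝 (∫ z, Real.exp (f z) ∂ν)) :=
    hν e
  refine le_of_tendsto_of_tendsto (hμ f) (hB.add (he.log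
    (integral_exp_pos_of_abs_le f.continuous.measurable hfM).ne')) ?_
  filter_upwards [h] with k hk
  exact hk f ‖f‖ f.continuous.measurable hfM

variable {α lam β Lam T : ℝ} {h : ℕ → ℝ} {N : ℕ → ℕ}

lemma tendsto_sq_factor (h0 : Tendsto h atTop (𝓝 0)) :
    Tendsto (fun k => 1 - 2 * α * h k + β ^ 2 * h k ^ 2) atTop (𝓝 1) := by
  have : Tendsto (fun t : ℝ => 1 - 2 * α * t + β ^ 2 * t ^ 2) (𝓝 0) (𝓝 1) := by
    have hc : Continuous fun t : ℝ => 1 - 2 * α * t + β ^ 2 * t ^ 2 := by fun_prop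
    simpa using hc.tendsto 0
  exact this.comp h0

/-- The power equals exp(-(N h)·slope), where the slope is that of t ↦ log(1 - 2αt + β²t²) between 0
and h and tends to the derivative -2α. -/
lemma tendsto_inv_sq_factor_pow (hpos : ∀ k, 0 < h k) (h0 : Tendsto h atTop (𝓝 0))
    (hT : Tendsto (fun k => N k * h k) atTop (𝓝 T)) :
    Tendsto (fun k => (1 - 2 * α * h k + β ^ 2 * h k ^ 2)⁻¹ ^ N k) atTop
      (𝓝 (Real.exp (2 * α * T))) := by
  have hder : HasDerivAt (fun t : ℝ => Real.log (1 - 2 * α * t + β ^ 2 * t ^ 2)) (-(2 * α)) 0 := by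
    have h1 : HasDerivAt (fun t : ℝ => 1 - 2 * α * t + β ^ 2 * t ^ 2) (-(2 * α)) 0 := by
      have := (((hasDerivAt_id (0 : ℝ)).const_mul (2 * α)).const_sub 1).add
        (((hasDerivAt_id (0 : ℝ)).pow 2).const_mul (β ^ 2))
      simp only [id_eq, mul_one, Nat.cast_ofNat, Nat.add_one_sub_one, pow_one, mul_zero,
        add_zero] at this
      exact this
    have := h1.log (by norm_num)
    simpa using this
  have hslope := hder.tendsto_slope
  have hh : Tendsto h atTop (𝓝[≠] 0) :=
    tendsto_nhdsWithin_iff.2 ⟨h0, Eventually.of_forall fun k => (hpos k).ne'⟩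
  have h1 := (hT.mul (hslope.comp hh)).neg
  have h2 := (Real.continuous_exp.tendsto _).comp h1
  rw [show -(T * -(2 * α)) = 2 * α * T by ring] at h2
  refine h2.congr' ?_
  filter_upwards [(tendsto_sq_factor (α := α) (β := β) h0).eventually (lt_mem_nhds one_pos)]
    with k hk
  have hk0 := (hpos k).ne'
  simp only [Function.comp_apply, slope_def_field, mul_zero, sub_zero, ne_eq,
    OfNat.ofNat_ne_zero, not_false_eq_true, zero_pow, add_zero, Real.log_one]
  rw [mul_assoc, mul_div_cancel₀ _ hk0, Real.exp_neg, Real.exp_nat_mul, Real.exp_log hk, inv_pow]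

lemma tendsto_mul_stepConst (hpos : ∀ k, 0 < h k) (h0 : Tendsto h atTop (𝓝 0)) :
    Tendsto (fun k => h k * stepConst α lam β Lam (h k)) atTop (𝓝 (1 / (2 * lam))) := by
  have h1 := ((tendsto_sq_factor (α := α) (β := β) h0).div_const (2 * lam)).add
    (h0.mul_const (2 * (β - α) * (Lam / lam) ^ 3 / lam))
  rw [zero_mul, add_zero] at h1
  refine h1.congr fun k => ?_
  have hk0 := (hpos k).ne'
  rw [stepConst, mul_add, ← mul_div_assoc (h k) (1 - _ + _), mul_comm (h k) (1 - _ + _),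
    mul_div_mul_right _ _ hk0]

/-- The constant C grows like 1/h while L⁻² - 1 is of order h, so their product has a limit. Since α
≠ 0, the ratio L⁻² eventually differs from 1 and the geometric sum has its closed form. -/
lemma tendsto_stepConst_div_geom_sum (hlam : 0 < lam) (hα : α ≠ 0) (hT0 : 0 < T)
    (hpos : ∀ k, 0 < h k) (h0 : Tendsto h atTop (𝓝 0))
    (hT : Tendsto (fun k => N k * h k) atTop (𝓝 T)) :
    Tendsto (fun k => stepConst α lam β Lam (h k) /
      ∑ i ∈ Finset.range (N k), (1 - 2 * α * h k + β ^ 2 * h k ^ 2)⁻¹ ^ i) atTop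
      (𝓝 (α / (lam * (Real.exp (2 * α * T) - 1)))) := by
  have hE : Real.exp (2 * α * T) - 1 ≠ 0 := by
    rw [sub_ne_zero, ne_eq, Real.exp_eq_one_iff]
    positivity
  have hnum : Tendsto (fun k => 2 * α - β ^ 2 * h k) atTop (𝓝 (2 * α)) := by
    simpa using (h0.const_mul (β ^ 2)).const_sub (2 * α)
  have hsq := tendsto_sq_factor (α := α) (β := β) h0
  have hlim := ((tendsto_mul_stepConst (α := α) (lam := lam) (β := β) (Lam := Lam) hpos h0).mul
    (hnum.div hsq one_ne_zero)).div
    ((tendsto_inv_sq_factor_pow (α := α) (β := β) hpos h0 hT).sub_const 1) hE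
  have hval : 1 / (2 * lam) * (2 * α / 1) / (Real.exp (2 * α * T) - 1) =
      α / (lam * (Real.exp (2 * α * T) - 1)) := by
    field_simp
  rw [hval] at hlim
  refine hlim.congr' ?_
  filter_upwards [hsq.eventually (lt_mem_nhds one_pos),
    hnum.eventually_ne (mul_ne_zero two_ne_zero hα)] with k hk hk2
  have hk0 := (hpos k).ne'
  have hdiff : (1 - 2 * α * h k + β ^ 2 * h k ^ 2)⁻¹ - 1 =
      h k * ((2 * α - β ^ 2 * h k) / (1 - 2 * α * h k + β ^ 2 * h k ^ 2)) := by
    rw [inv_eq_one_div, div_sub_one hk.ne', mul_div_assoc']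
    congr 1
    ring
  have hq : (1 - 2 * α * h k + β ^ 2 * h k ^ 2)⁻¹ ≠ 1 := by
    rw [← sub_ne_zero, hdiff]
    exact mul_ne_zero hk0 (div_ne_zero hk2 hk.ne')
  rw [geom_sum_eq hq, hdiff, div_div_eq_mul_div]
  simp only [Pi.div_apply]
  ring

end Limit

end MultNoise

/-! ### The main theorem. -/

theorem theorem5p3 {d m : ℕ}
    (b : ℝ → EuclideanSpace ℝ (Fin d) → EuclideanSpace ℝ (Fin d))
    (σ : ℝ → EuclideanSpace ℝ (Fin d) → Matrix (Fin d) (Fin m) ℝ)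
    (α lam β Lam : ℝ)
    {Ω : Type*} [MeasurableSpace Ω] (P : Measure Ω) [IsProbabilityMeasure P]
    (ξ : ℕ → Ω → EuclideanSpace ℝ (Fin m))
    (hξ_indep : iIndepFun ξ P)
    (hξ_law : ∀ n, HasLaw (ξ n) (stdGaussian (EuclideanSpace ℝ (Fin m))) P)
    (x y : EuclideanSpace ℝ (Fin d)) :
    -- the bound for the Euler scheme
    (∀ (h : ℝ) (N : ℕ), 0 < h → 1 ≤ N →
      MultNoise.MonotoneElliptic b σ (N * h) α lam →
      MultNoise.LipschitzBounded b σ (N * h) β Lam →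
      ∀ L : ℝ, 0 < L → L ^ 2 = 1 - 2 * α * h + β ^ 2 * h ^ 2 →
        (L ≠ 1 →
          klDiv (P.map (MultNoise.euler b σ h ξ x N)) (P.map (MultNoise.euler b σ h ξ y N)) ≤
            ENNReal.ofReal
              ((1 + 4 * (β - α) * (Lam / lam) ^ 3 * h / L ^ 2) *
                ((α - β ^ 2 * h / 2) / (lam * (L ^ (-(2 * (N : ℤ))) - 1))) * ‖x - y‖ ^ 2)) ∧
        (L = 1 →
          klDiv (P.map (MultNoise.euler b σ h ξ x N)) (P.map (MultNoise.euler b σ h ξ y N)) ≤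
            ENNReal.ofReal
              ((1 + 4 * (β - α) * (Lam / lam) ^ 3 * h / L ^ 2) *
                (1 / (2 * lam * (N * h))) * ‖x - y‖ ^ 2)) ∧
        (L < 1 →
          klDiv (P.map (MultNoise.euler b σ h ξ x N)) (P.map (MultNoise.euler b σ h ξ y N)) ≤
            ENNReal.ofReal
              ((1 + 4 * (β - α) * (Lam / lam) ^ 3 * h / L ^ 2) *
                (α * (1 - β * h / 2) / (lam * (L ^ (-(2 * (N : ℤ))) - 1))) * ‖x - y‖ ^ 2))) ∧
    -- the limit as the step size tends to zero
    (∀ T S : ℝ, 0 < T →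
      MultNoise.MonotoneElliptic b σ S α lam →
      MultNoise.LipschitzBounded b σ S β Lam →
      ∀ (h : ℕ → ℝ) (N : ℕ → ℕ), (∀ k, 0 < h k) → (∀ k, N k * h k ≤ S) →
        Tendsto h atTop (𝓝 0) → Tendsto (fun k => N k * h k) atTop (𝓝 T) →
        ∀ (μ ν : Measure (EuclideanSpace ℝ (Fin d))) [IsProbabilityMeasure μ]
          [IsProbabilityMeasure ν],
          MultNoise.WeaklyTendsto (fun k => P.map (MultNoise.euler b σ (h k) ξ x (N k))) μ →
          MultNoise.WeaklyTendsto (fun k => P.map (MultNoise.euler b σ (h k) ξ y (N k))) ν →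
          (α ≠ 0 → klDiv μ ν ≤
            ENNReal.ofReal (α * ‖x - y‖ ^ 2 / (lam * (Real.exp (2 * α * T) - 1)))) ∧
          (α = 0 → klDiv μ ν ≤ ENNReal.ofReal (‖x - y‖ ^ 2 / (2 * lam * T)))) := by
  constructor
  · intro h N hh hN hM hLip L hL hL2
    have hpos : 0 < 1 - 2 * α * h + β ^ 2 * h ^ 2 := hL2 ▸ pow_pos hL 2
    have hlam := hM.lam_pos
    have hX := fun x => MultNoise.aemeasurable_euler
      (MultNoise.measurable_eulerStep_of_lt hM hLip hh le_rfl)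
      (fun n => (hξ_law n).aemeasurable) x le_rfl
    have := Measure.isProbabilityMeasure_map (hX x)
    have := Measure.isProbabilityMeasure_map (hX y)
    have hDV := MultNoise.dvBound_euler hM hLip hh hN le_rfl hξ_indep hξ_law hpos x y
    rw [← hL2] at hDV
    have hne : L ≠ 1 →
        klDiv (P.map (MultNoise.euler b σ h ξ x N)) (P.map (MultNoise.euler b σ h ξ y N)) ≤
          ENNReal.ofReal
            ((1 + 4 * (β - α) * (Lam / lam) ^ 3 * h / L ^ 2) *
              ((α - β ^ 2 * h / 2) / (lam * (L ^ (-(2 * (N : ℤ))) - 1))) * ‖x - y‖ ^ 2) := by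
      intro hL1
      rw [MultNoise.stepConst_div_geom_sum_eq hlam hh hL hL2 hL1] at hDV
      exact hDV.klDiv_le
    refine ⟨hne, fun hL1 => ?_, fun hL1 => ?_⟩
    · rw [MultNoise.stepConst_div_geom_sum_eq_of_one hlam hh hN hL1 hL2] at hDV
      exact hDV.klDiv_le
    · refine (hne hL1.ne).trans (ENNReal.ofReal_le_ofReal ?_)
      rcases eq_or_ne x y with rfl | hxy
      · simp
      have hαβ := sub_nonneg.2 (MultNoise.alpha_le_beta hM hLip (by positivity) hxy)
      have hβ := hLip.beta_pos
      have hLam := hLip.Lam_pos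
      have hden : 0 < L ^ (-(2 * (N : ℤ))) - 1 := by
        rw [← MultNoise.inv_sq_pow_eq_zpow, sub_pos]
        refine one_lt_pow₀ ((one_lt_inv₀ (by positivity)).2 ?_) (by omega)
        exact pow_lt_one₀ hL.le hL1 two_ne_zero
      -- The two sides differ by (β - α)βh/2; L < 1 makes the denominator positive, so the quotient
      -- inherits the order.
      have hnum : α - β ^ 2 * h / 2 ≤ α * (1 - β * h / 2) := by
        have : 0 ≤ (β - α) * (β * h) := by positivity
        linarith
      gcongr
  · intro T S hT hM hLip h N hh hNS h0 hNT μ ν _ _ hμ hν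
    have hlam := hM.lam_pos
    have hsq := MultNoise.tendsto_sq_factor (α := α) (β := β) h0
    have hev : ∀ᶠ k in atTop, MultNoise.DVBound (P.map (MultNoise.euler b σ (h k) ξ x (N k)))
        (P.map (MultNoise.euler b σ (h k) ξ y (N k)))
        (MultNoise.stepConst α lam β Lam (h k) / (∑ i ∈ Finset.range (N k),
          (1 - 2 * α * h k + β ^ 2 * h k ^ 2)⁻¹ ^ i) * ‖x - y‖ ^ 2) := by
      filter_upwards [hsq.eventually (lt_mem_nhds one_pos), hNT.eventually (lt_mem_nhds hT)]
        with k hk hNk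
      refine MultNoise.dvBound_euler hM hLip (hh k) ?_ (hNS k) hξ_indep hξ_law hk x y
      refine Nat.one_le_iff_ne_zero.2 fun hzero => ?_
      simp [hzero] at hNk
    constructor
    · intro hα
      have hlim := (MultNoise.tendsto_stepConst_div_geom_sum (β := β) (Lam := Lam) hlam hα hT hh h0
        hNT).mul_const (‖x - y‖ ^ 2)
      rw [div_mul_eq_mul_div] at hlim
      exact (MultNoise.DVBound.of_weaklyTendsto hμ hν hlim hev).klDiv_le
    · intro hα
      -- For α = 0 the ratio L⁻² = (1 + β²h²)⁻¹ is at most 1, so the geometric sum is at least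
      -- N·L^{-2N}. As L^{-2N} → 1, this crude lower bound already gives the sharp limit.
      have hpow := MultNoise.tendsto_inv_sq_factor_pow (α := α) (β := β) hh h0 hNT
      have hone : Real.exp (2 * α * T) = 1 := by simp [hα]
      rw [hone] at hpow
      have hlim := (((MultNoise.tendsto_mul_stepConst (α := α) (lam := lam) (β := β) (Lam := Lam)
        hh h0).div (hNT.mul hpow) (by simpa using hT.ne')).mul_const (‖x - y‖ ^ 2))
      have hval : 1 / (2 * lam) / (T * 1) * ‖x - y‖ ^ 2 = ‖x - y‖ ^ 2 / (2 * lam * T) := by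
        field_simp
      rw [hval] at hlim
      refine (MultNoise.DVBound.of_weaklyTendsto hμ hν hlim ?_).klDiv_le
      filter_upwards [hev, hNT.eventually (lt_mem_nhds hT)] with k hk hNk
      refine hk.mono ?_
      have hhk := hh k
      have hβ := hLip.beta_pos
      have hLam := hLip.Lam_pos
      have hNpos : (0 : ℝ) < N k := by
        by_contra! hle
        exact absurd hNk (not_lt.2 (mul_nonpos_of_nonpos_of_nonneg hle hhk.le))
      simp only [Pi.div_apply, hα, mul_zero, zero_mul, sub_zero]
      have hC : 0 ≤ MultNoise.stepConst 0 lam β Lam (h k) := by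
        simp only [MultNoise.stepConst, mul_zero, zero_mul, sub_zero]
        positivity
      have hq1 : (1 + β ^ 2 * h k ^ 2)⁻¹ ≤ 1 := inv_le_one_of_one_le₀ (by
        have : 0 ≤ β ^ 2 * h k ^ 2 := by positivity
        linarith)
      have hsum : (N k : ℝ) * (1 + β ^ 2 * h k ^ 2)⁻¹ ^ N k ≤
          ∑ i ∈ Finset.range (N k), (1 + β ^ 2 * h k ^ 2)⁻¹ ^ i := by
        have := Finset.card_nsmul_le_sum (Finset.range (N k))
          (fun i => (1 + β ^ 2 * h k ^ 2)⁻¹ ^ i) ((1 + β ^ 2 * h k ^ 2)⁻¹ ^ N k)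
          fun i hi => pow_le_pow_of_le_one (by positivity) hq1 (Finset.mem_range.1 hi).le
        rwa [Finset.card_range, nsmul_eq_mul] at this
      have he : h k * MultNoise.stepConst 0 lam β Lam (h k) /
          (N k * h k * (1 + β ^ 2 * h k ^ 2)⁻¹ ^ N k) =
          MultNoise.stepConst 0 lam β Lam (h k) / (N k * (1 + β ^ 2 * h k ^ 2)⁻¹ ^ N k) := by
        rw [mul_comm (h k), mul_right_comm, mul_div_mul_right _ _ hhk.ne']
      rw [he]
      gcongr
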